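/- **Definitions.** Let $R$ be a commutative $\mathbb{Q}$-algebra. Put $$\mathfrak M^1(R)=\Big\{\sum_{n\ge1}\alpha_nz^n\Big\}=zR[[z]],\qquad \mathfrak G^1_+(R)=\{z+\alpha_2z^2+\cdots\}\subset\mathfrak M^1(R),\qquad \Lambda(R)=1+zR[[z]].$$ For $f=\sum\alpha_nz^n$ and $g=\sum\beta_nz^n$ in $\mathfrak M^1(R)$ the boxed convolution $f\boxtimes g\in\mathfrak M^1(R)$ has, for $n\ge1$, the coefficients $$(f\boxtimes g)_n=\sum_{\pi\in \mathrm{NC}(n)}\ \prod_{V\in\pi}\alpha_{|V|}\prod_{W\in K(\pi)}\beta_{|W|},$$ where $\mathrm{NC}(n)$ is the set of non-crossing partitions of $\{1,\dots,n\}$ and $K(\pi)$ is the Kreweras complement of $\pi$, i.e. the largest non-crossing partition of $\{\bar1,\dots,\bar n\}$ for which $\pi\cup K(\pi)$ is a non-crossing partition of $1<\bar1<\cdots<n<\bar n$. Let $\mathrm{Zeta}=z+z^2+z^3+\cdots$, let $\mathrm{Moeb}$ be its inverse for $\boxtimes$ (the unit of $\boxtimes$ being $z$), and put $$f\boxplus_V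 g=(f\boxtimes\mathrm{Moeb}+g\boxtimes\mathrm{Moeb})\boxtimes\mathrm{Zeta},\qquad f\boxtimes_V g=f\boxtimes\mathrm{Moeb}\boxtimes g .$$ Writing $f^{-1}$ for the inverse of $f\in\mathfrak G^1_+(R)$ under composition, put $$\mathcal F(f)=\tfrac1z f^{-1}(z),\qquad \mathcal S_V(f)=\tfrac{1+z}{z}f^{-1}(z).$$ Let $\mathrm{id}:\mathfrak M^1(R)\to R[[z]]$ be the identification through coefficient sequences, $\sum_{n\ge1}\alpha_nz^n\mapsto\sum_{n\ge0}\alpha_{n+1}z^n$. Further let $$\mathrm{LOG}=\tfrac{d}{dz}\log\mathcal F:\mathfrak G^1_+(R)\to R[[z]],\qquad \mathrm{EXP}=\mathrm{LOG}^{-1}\circ\mathrm{id}:\mathfrak M^1(R)\to\mathfrak G^1_+(R),$$ $$\mathcal R_V(m)=m\boxtimes\mathrm{Moeb},\qquad \mathrm{EXP}_V(m)=\mathrm{EXP}(m\boxtimes\mathrm{Moeb})\boxtimes\mathrm{Zeta},\qquad \mathrm{LOG}_V=\mathrm{EXP}_V^{-1}.$$ **Theorem.** Let $R$ be a commutative $\mathbb{Q}$-algebra.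 The inverse $\mathrm{Moeb}$ exists, $(\mathfrak G^1_+(R),\boxtimes)$, $(\mathfrak G^1_+(R),\boxtimes_V)$, $(\Lambda(R),\cdot)$, $(R[[z]],+)$, $(\mathfrak M^1(R),+)$ and $(\mathfrak M^1(R),\boxplus_V)$ are abelian groups (with neutral elements $z$, $\mathrm{Zeta}$, $1$, $0$, $0$, $0$), and the following maps are isomorphisms of abelian groups, natural in $R$: * $-\boxtimes\mathrm{Zeta}:(\mathfrak G^1_+(R),\boxtimes)\to(\mathfrak G^1_+(R),\boxtimes_V)$ and $-\boxtimes\mathrm{Zeta}:(\mathfrak M^1(R),+)\to(\mathfrak M^1(R),\boxplus_V)$; * $\mathcal F:(\mathfrak G^1_+(R),\boxtimes)\to(\Lambda(R),\cdot)$ and $\mathcal S_V:(\mathfrak G^1_+(R),\boxtimes_V)\to(\Lambda(R),\cdot)$; * $\frac{d}{dz}\log:(\Lambda(R),\cdot)\to(R[[z]],+)$; * $\mathrm{id}:(\mathfrak M^1(R),+)\to(R[[z]],+)$ and $\mathrm{id}\circ\mathcal R_V:(\mathfrak M^1(R),\boxplus_V)\to(R[[z]],+)$; * $\mathrm{EXP}:(\mathfrak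 M^1(R),+)\to(\mathfrak G^1_+(R),\boxtimes)$ and $\mathrm{EXP}_V:(\mathfrak M^1(R),\boxplus_V)\to(\mathfrak G^1_+(R),\boxtimes_V)$. In particular $\mathrm{LOG}$ and $\mathrm{LOG}_V$ are well defined isomorphisms. The diagram formed by these maps commutes, i.e. $$\mathcal S_V(f\boxtimes\mathrm{Zeta})=\mathcal F(f),\qquad \tfrac{d}{dz}\log\mathcal F(\mathrm{EXP}(h))=\mathrm{id}(h),\qquad \tfrac{d}{dz}\log\mathcal S_V(\mathrm{EXP}_V(m))=\mathrm{id}(\mathcal R_V(m)),$$ $$\mathcal R_V(h\boxtimes\mathrm{Zeta})=h,\qquad \mathrm{EXP}_V(h\boxtimes\mathrm{Zeta})=\mathrm{EXP}(h)\boxtimes\mathrm{Zeta}$$ for $f\in\mathfrak G^1_+(R)$ and $h,m\in\mathfrak M^1(R)$. Consequently the multiplicative free convolution is reduced to the additive one: $$f\boxtimes_Vg=\mathrm{EXP}_V\big(\mathrm{LOG}_V(f)\boxplus_V\mathrm{LOG}_V(g)\big),\qquad f,g\in\mathfrak G^1_+(R).$$ Finally, let $k$ be a commutative ring over which $R$ is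 also an algebra, $A$ a unital $k$-algebra and $\phi:A\to R$ a $k$-linear map with $\phi(1)=1$. Let the free cumulants $\kappa_n:A^n\to R$ be defined recursively by $\phi(a_1\cdots a_n)=\sum_{\pi\in\mathrm{NC}(n)}\prod_{V\in\pi}\kappa_{|V|}\big((a_v)_{v\in V}\big)$, $n\ge1$. For $a\in A$ let $\mathcal M(a)=\sum_{n\ge1}\phi(a^n)z^n$ and $\mathcal R(a)=\sum_{n\ge1}\kappa_n(a,\dots,a)z^n$. Then $\mathcal M(a)=\mathcal R(a)\boxtimes\mathrm{Zeta}$ and $\mathcal R_V(\mathcal M(a))=\mathcal R(a)$. -/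

import Mathlib

open PowerSeries

namespace FreeConv

/-! ### Non-crossing partitions and the Kreweras complement -/

/-- A relation on a linearly ordered set is non-crossing if `p₁ < q₁ < p₂ < q₂`, `p₁ ∼ p₂` and
`q₁ ∼ q₂` force `q₁ ∼ p₂`. -/
def NonCrossing {α : Type*} [LinearOrder α] (r : α → α → Prop) : Prop :=
  ∀ p₁ q₁ p₂ q₂ : α, p₁ < q₁ → q₁ < p₂ → p₂ < q₂ → r p₁ p₂ → r q₁ q₂ → r q₁ p₂

/-- Partitions of an `n`-element set, `1, …, n` being represented by `0, …, n - 1`. -/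
abbrev Part (n : ℕ) : Type := Finpartition (Finset.univ : Finset (Fin n))

/-- `i ∼_π j`: some block of `π` contains both `i` and `j`. -/
def SameBlock {n : ℕ} (π : Part n) (i j : Fin n) : Prop :=
  ∃ V ∈ π.parts, i ∈ V ∧ j ∈ V

instance {n : ℕ} (π : Part n) (i j : Fin n) : Decidable (SameBlock π i j) :=
  inferInstanceAs (Decidable (∃ V ∈ π.parts, i ∈ V ∧ j ∈ V))

instance {n : ℕ} (π : Part n) : Decidable (NonCrossing (SameBlock π)) :=
  inferInstanceAs (Decidable (∀ p₁ q₁ p₂ q₂ : Fin n, p₁ < q₁ → q₁ < p₂ → p₂ < q₂ →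
    SameBlock π p₁ p₂ → SameBlock π q₁ q₂ → SameBlock π q₁ p₂))

/-- The finite set `NC(n)` of non-crossing partitions. -/
def NC (n : ℕ) : Finset (Part n) :=
  {π | NonCrossing (SameBlock π)}

/-- The partition `π ∪ σ` of the ordered set `1 < 1̄ < 2 < 2̄ < ⋯ < n < n̄`, where `π` is placed on
the points `i = (i, false)` and `σ` on the points `ī = (i, true)`. -/
def UnionRel {n : ℕ} (π σ : Part n) (x y : Fin n ×ₗ Bool) : Prop :=
  ((ofLex x).2 = false ∧ (ofLex y).2 = false ∧ SameBlock π (ofLex x).1 (ofLex y).1) ∨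
  ((ofLex x).2 = true ∧ (ofLex y).2 = true ∧ SameBlock σ (ofLex x).1 (ofLex y).1)

/-- `ī ∼ j̄` when no block of `π` is separated by `ī` and `j̄` in `1 < 1̄ < ⋯ < n < n̄`. -/
def krewerasSetoid {n : ℕ} (π : Part n) : Setoid (Fin n) where
  r i j := ∀ a b : Fin n, SameBlock π a b → ((i < a ↔ j < a) ↔ (i < b ↔ j < b))
  iseqv := ⟨fun _ _ _ _ => by tauto, fun h a b hab => by have := h a b hab; tauto,
    fun h h' a b hab => by have := h a b hab; have := h' a b hab; tauto⟩

instance {n : ℕ} (π : Part n) : DecidableRel (krewerasSetoid π).r := fun i j =>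
  inferInstanceAs (Decidable (∀ a b : Fin n, SameBlock π a b →
    ((i < a ↔ j < a) ↔ (i < b ↔ j < b))))

/-- The Kreweras complement of `π`; by `isGreatest_kreweras` it is the largest partition `σ` of
`1̄, …, n̄` such that `σ` and `π ∪ σ` are non-crossing. -/
def kreweras {n : ℕ} (π : Part n) : Part n :=
  Finpartition.ofSetoid (krewerasSetoid π)

lemma sameBlock_iff {n : ℕ} (π : Part n) (i j : Fin n) : SameBlock π i j ↔ i ∈ π.part j :=
  π.mem_part_iff_exists.symm

lemma SameBlock.symm {n : ℕ} {π : Part n} {i j : Fin n} (h : SameBlock π i j) :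
    SameBlock π j i :=
  let ⟨V, hV, hi, hj⟩ := h
  ⟨V, hV, hj, hi⟩

lemma sameBlock_kreweras {n : ℕ} (π : Part n) (i j : Fin n) :
    SameBlock (kreweras π) i j ↔
      ∀ a b : Fin n, SameBlock π a b → ((i < a ↔ j < a) ↔ (i < b ↔ j < b)) := by
  have h : SameBlock (kreweras π) j i ↔ (krewerasSetoid π) i j :=
    (sameBlock_iff _ _ _).trans Finpartition.mem_part_ofSetoid_iff_rel
  exact ⟨fun hh => h.1 hh.symm, fun hh => (h.2 hh).symm⟩

lemma part_le_iff {n : ℕ} (σ τ : Part n) :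
    σ ≤ τ ↔ ∀ i j, SameBlock σ i j → SameBlock τ i j := by
  constructor
  · rintro h i j ⟨V, hV, hi, hj⟩
    obtain ⟨W, hW, hVW⟩ := h hV
    exact ⟨W, hW, hVW hi, hVW hj⟩
  · intro h V hV
    obtain ⟨i, hi⟩ := σ.nonempty_of_mem_parts hV
    refine ⟨τ.part i, τ.part_mem.2 (Finset.mem_univ i), fun j hj => ?_⟩
    exact (sameBlock_iff _ _ _).1 (h j i ⟨V, hV, hj, hi⟩)

lemma isGreatest_kreweras {n : ℕ} (π : Part n) (hπ : NonCrossing (SameBlock π)) :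
    IsGreatest {σ : Part n | NonCrossing (SameBlock σ) ∧ NonCrossing (UnionRel π σ)}
      (kreweras π) := by
  have hK : NonCrossing (SameBlock (kreweras π)) := by
    intro p₁ q₁ p₂ q₂ h₁ h₂ h₃ hp hq
    rw [sameBlock_kreweras] at *
    intro a b hab
    have := hp a b hab
    have := hq a b hab
    grind
  refine ⟨⟨hK, ?_⟩, ?_⟩
  · rintro x y z w h₁ h₂ h₃ hp hq
    rw [Prod.Lex.lt_iff] at h₁ h₂ h₃
    rcases hp with ⟨hx, hz, hp⟩ | ⟨hx, hz, hp⟩ <;> rcases hq with ⟨hy, hw, hq⟩ | ⟨hy, hw, hq⟩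
    · refine Or.inl ⟨hy, hz, hπ _ _ _ _ ?_ ?_ ?_ hp hq⟩ <;> simp_all
    · rw [sameBlock_kreweras] at hq
      have := hq _ _ hp
      have htf : ¬ (true < false) := by decide
      simp_all only [and_false, or_false]
      grind
    · rw [sameBlock_kreweras] at hp
      have := hp _ _ hq
      have htf : ¬ (true < false) := by decide
      simp_all only [and_false, or_false]
      grind
    · refine Or.inr ⟨hy, hz, hK _ _ _ _ ?_ ?_ ?_ hp hq⟩ <;> simp_all
  · rintro σ ⟨-, hσ⟩
    rw [part_le_iff]
    have key : ∀ i j a b : Fin n, i < j → SameBlock σ i j → SameBlock π a b →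
        i < a → a ≤ j → i < b ∧ b ≤ j := by
      intro i j a b hij hs hp hia haj
      constructor
      · by_contra hb
        have := hσ (toLex (b, false)) (toLex (i, true)) (toLex (a, false)) (toLex (j, true))
          (by rw [Prod.Lex.lt_iff]; simp; exact (not_lt.1 hb).lt_or_eq)
          (by rw [Prod.Lex.lt_iff]; simp [hia])
          (by rw [Prod.Lex.lt_iff]; simp; exact haj.lt_or_eq)
          (Or.inl ⟨rfl, rfl, hp.symm⟩) (Or.inr ⟨rfl, rfl, hs⟩)
        simp [UnionRel] at this
      · by_contra hb
        have := hσ (toLex (i, true)) (toLex (a, false)) (toLex (j, true)) (toLex (b, false))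
          (by rw [Prod.Lex.lt_iff]; simp [hia])
          (by rw [Prod.Lex.lt_iff]; simp; exact haj.lt_or_eq)
          (by rw [Prod.Lex.lt_iff]; simp [not_le.1 hb])
          (Or.inr ⟨rfl, rfl, hs⟩) (Or.inl ⟨rfl, rfl, hp⟩)
        simp [UnionRel] at this
    intro i j hs
    rw [sameBlock_kreweras]
    intro a b hp
    rcases lt_trichotomy i j with h | h | h
    · have := key i j a b h hs hp
      have := key i j b a h hs hp.symm
      grind
    · subst h; simp
    · have := key j i a b h hs.symm hp
      have := key j i b a h hs.symm hp.symm
      grind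

/-! ### Boxed convolution in one variable -/

section Ring

variable {R : Type*} [CommRing R]

/-- `∏_{V ∈ π} α_{|V|}` for `f = ∑ αₙ zⁿ`. -/
noncomputable def blockProd {n : ℕ} (f : R⟦X⟧) (π : Part n) : R :=
  ∏ V ∈ π.parts, coeff V.card f

/-- The coefficient of degree `n ≥ 1` of `f ⊠ g`. -/
noncomputable def boxCoeff (f g : R⟦X⟧) (n : ℕ) : R :=
  ∑ π ∈ NC n, blockProd f π * blockProd g (kreweras π)

variable (R) in
/-- `𝔐¹(R)`: power series without constant term. -/
abbrev M1 : Type _ := {f : R⟦X⟧ // constantCoeff f = 0}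

variable (R) in
/-- `𝔊¹₊(R)`: power series `z + α₂ z² + ⋯`. -/
abbrev G1 : Type _ := {f : R⟦X⟧ // constantCoeff f = 0 ∧ coeff 1 f = 1}

variable (R) in
/-- `Λ(R)`: power series `1 + α₁ z + ⋯`. -/
abbrev Lam : Type _ := {f : R⟦X⟧ // constantCoeff f = 1}

/-- The inclusion `𝔊¹₊(R) ⊆ 𝔐¹(R)`. -/
def G1.toM1 (f : G1 R) : M1 R := ⟨f.1, f.2.1⟩

/-- The boxed convolution `⊠` on series without constant term. -/
noncomputable def M1.box (f g : M1 R) : M1 R :=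
  ⟨PowerSeries.mk fun n => if n = 0 then 0 else boxCoeff f.1 g.1 n, by
    rw [← coeff_zero_eq_constantCoeff_apply, coeff_mk, if_pos rfl]⟩

lemma part_one (π : Part 1) : π.parts = {Finset.univ} := by
  have h : ∀ V ∈ π.parts, V = Finset.univ := by
    intro V hV
    obtain ⟨i, hi⟩ := π.nonempty_of_mem_parts hV
    ext j
    exact ⟨fun _ => Finset.mem_univ j, fun _ => Subsingleton.elim i j ▸ hi⟩
  refine Finset.eq_singleton_iff_unique_mem.2 ⟨?_, h⟩
  have h0 := π.part_mem.2 (Finset.mem_univ (0 : Fin 1))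
  rwa [h _ h0] at h0

lemma NC_one : NC 1 = {⊤} := by
  refine Finset.eq_singleton_iff_unique_mem.2 ⟨?_, ?_⟩
  · simp only [NC, Finset.mem_filter, Finset.mem_univ, true_and]
    intro p₁ q₁ p₂ q₂ h
    exact absurd h (by simp [Subsingleton.elim p₁ q₁])
  · intro π _
    exact Finpartition.ext ((part_one π).trans (part_one _).symm)

lemma coeff_one_box (f g : M1 R) :
    coeff 1 (M1.box f g).1 = coeff 1 f.1 * coeff 1 g.1 := by
  simp [M1.box, boxCoeff, NC_one, blockProd, part_one]

/-- The boxed convolution `⊠` on `𝔊¹₊(R)`. -/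
noncomputable def G1.box (f g : G1 R) : G1 R :=
  ⟨(M1.box f.toM1 g.toM1).1, (M1.box f.toM1 g.toM1).2, by
    rw [coeff_one_box]; simp [G1.toM1, f.2.2, g.2.2]⟩

/-- The series `z`, the unit of `⊠`. -/
noncomputable def G1.one : G1 R := ⟨X, by simp⟩

variable (R) in
/-- The Zeta function `z + z² + z³ + ⋯`. -/
noncomputable def zeta : G1 R :=
  ⟨PowerSeries.mk fun n => if n = 0 then 0 else 1, by
    constructor
    · rw [← coeff_zero_eq_constantCoeff_apply, coeff_mk, if_pos rfl]
    · simp⟩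

instance : Nonempty (G1 R) := ⟨G1.one⟩

variable (R) in
/-- The Möbius function: the inverse of the Zeta function with respect to `⊠`. -/
noncomputable def moeb : G1 R :=
  Classical.epsilon fun m => G1.box m (zeta R) = G1.one ∧ G1.box (zeta R) m = G1.one

/-- Zero of `𝔐¹(R)`. -/
noncomputable def M1.zero : M1 R := ⟨0, by simp⟩

instance : Nonempty (M1 R) := ⟨M1.zero⟩

/-- Coefficientwise addition on `𝔐¹(R)`. -/
noncomputable def M1.add (f g : M1 R) : M1 R := ⟨f.1 + g.1, by simp [f.2, g.2]⟩

/-- Right `⊠`-multiplication by the Zeta function. -/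
noncomputable def M1.mulZeta (f : M1 R) : M1 R := M1.box f (zeta R).toM1

/-- Right `⊠`-multiplication by the Zeta function. -/
noncomputable def G1.mulZeta (f : G1 R) : G1 R := G1.box f (zeta R)

/-- Voiculescu's `R`-transform for moments, `m ↦ m ⊠ Moeb`. -/
noncomputable def RV (m : M1 R) : M1 R := M1.box m (moeb R).toM1

/-- `f ⊞_V g = (f ⊠ Moeb + g ⊠ Moeb) ⊠ Zeta`. -/
noncomputable def M1.boxAddV (f g : M1 R) : M1 R :=
  M1.box (M1.add (M1.box f (moeb R).toM1) (M1.box g (moeb R).toM1)) (zeta R).toM1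

/-- `f ⊠_V g = f ⊠ Moeb ⊠ g`. -/
noncomputable def G1.boxMulV (f g : G1 R) : G1 R := G1.box (G1.box f (moeb R)) g

/-- Multiplication of power series on `Λ(R)`. -/
noncomputable def Lam.mul (f g : Lam R) : Lam R := ⟨f.1 * g.1, by simp [f.2, g.2]⟩

/-- The constant series `1`. -/
noncomputable def Lam.one : Lam R := ⟨1, by simp⟩

/-! ### The transforms -/

/-- `f ↦ f / z`, that is `∑_{n ≥ 1} αₙ zⁿ ↦ ∑_{n ≥ 0} α_{n+1} zⁿ`. On `𝔐¹(R)` this is the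
identification of `𝔐¹(R)` with `R[[z]]` through their coefficient sequences. -/
noncomputable def divZ (f : R⟦X⟧) : R⟦X⟧ := PowerSeries.mk fun n => coeff (n + 1) f

lemma X_mul_divZ (f : R⟦X⟧) (hf : constantCoeff f = 0) : X * divZ f = f := by
  ext n
  cases n with
  | zero => simp [hf]
  | succ n => simp [divZ, coeff_succ_X_mul]

/-- The identification `𝔐¹(R) ≃ R[[z]]`. -/
noncomputable def M1.ident (f : M1 R) : R⟦X⟧ := divZ f.1

/-- The inverse of `f` with respect to composition of power series. -/
noncomputable def G1.compInv (f : G1 R) : R⟦X⟧ :=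
  substInvOfIsUnit f.1 (f.2.2.symm ▸ isUnit_one)

lemma G1.constantCoeff_divZ_compInv (f : G1 R) : constantCoeff (divZ f.compInv) = 1 := by
  have hu : IsUnit (coeff 1 f.1) := f.2.2.symm ▸ isUnit_one
  have h : coeff 1 (substInvOfIsUnit f.1 hu) = _ := coeff_one_substInvOfIsUnit f.1 hu
  rw [← coeff_zero_eq_constantCoeff_apply, divZ, coeff_mk, zero_add, G1.compInv, h]
  exact Units.val_eq_one.2 (inv_eq_one.2 (Units.ext f.2.2))

/-- The `F`-transform `f ↦ f⁻¹(z) / z`. -/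
noncomputable def FT (f : G1 R) : Lam R := ⟨divZ f.compInv, f.constantCoeff_divZ_compInv⟩

/-- The `S_V`-transform `f ↦ ((1 + z) / z) f⁻¹(z)`. -/
noncomputable def SV (f : G1 R) : Lam R :=
  ⟨(1 + X) * divZ f.compInv, by simp [f.constantCoeff_divZ_compInv]⟩

variable [Algebra ℚ R]

/-- `f ↦ d/dz log f` on `Λ(R)`. -/
noncomputable def dlog (f : Lam R) : R⟦X⟧ := derivative R (logOf f.1)

/-- `LOG f = d/dz log (F f)`. -/
noncomputable def LOG (f : G1 R) : R⟦X⟧ := dlog (FT f)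

/-- `EXP = LOG⁻¹`, as a map on `𝔐¹(R) ≃ R[[z]]`. -/
noncomputable def EXP (f : M1 R) : G1 R := Function.invFun LOG f.ident

/-- `EXP_V m = EXP (m ⊠ Moeb) ⊠ Zeta`. -/
noncomputable def EXPV (m : M1 R) : G1 R := (EXP (RV m)).mulZeta

/-- `LOG_V = EXP_V⁻¹`. -/
noncomputable def LOGV : G1 R → M1 R := Function.invFun EXPV

end Ring

/-! ### Base change -/

section Map

variable {R S : Type*} [CommRing R] [CommRing S]

/-- Base change on `𝔐¹`. -/
noncomputable def M1.map (φ : R →+* S) (f : M1 R) : M1 S :=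
  ⟨PowerSeries.map φ f.1, by
    rw [← coeff_zero_eq_constantCoeff_apply, coeff_map, coeff_zero_eq_constantCoeff_apply, f.2]; simp⟩

/-- Base change on `𝔊¹₊`. -/
noncomputable def G1.map (φ : R →+* S) (f : G1 R) : G1 S :=
  ⟨PowerSeries.map φ f.1, by
    rw [← coeff_zero_eq_constantCoeff_apply, coeff_map, coeff_zero_eq_constantCoeff_apply, f.2.1]; simp, by
    rw [coeff_map, f.2.2, map_one]⟩

/-- Base change on `Λ`. -/
noncomputable def Lam.map (φ : R →+* S) (f : Lam R) : Lam S :=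
  ⟨PowerSeries.map φ f.1, by
    rw [← coeff_zero_eq_constantCoeff_apply, coeff_map, coeff_zero_eq_constantCoeff_apply, f.2]; simp⟩

end Map

/-! ### Moments and free cumulants -/

section Prob

variable {A R : Type*} [Ring A] [CommRing R]

/-- The free cumulants `κₙ(a₁, …, aₙ)`, defined recursively by
`φ(a₁ ⋯ aₙ) = ∑_{π ∈ NC(n)} ∏_{V ∈ π} κ_{|V|}(a_v : v ∈ V)`: the partition with the single
block `{1, …, n}` contributes `κₙ(a₁, …, aₙ)`, all the others are moved to the other side. -/
noncomputable def freeCumulant (φ : A → R) : (n : ℕ) → (Fin n → A) → R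
  | n, a => φ (List.ofFn a).prod -
      ∑ π ∈ (NC n).filter (fun π => Finset.univ ∉ π.parts),
        ∏ V ∈ π.parts.attach,
          if _ : V.1.card < n then
            freeCumulant φ V.1.card (fun i => a (V.1.orderEmbOfFin rfl i))
          else 0
  termination_by n => n

/-- The moment-cumulant formula. -/
lemma moment_cumulant (φ : A → R) {n : ℕ} (hn : n ≠ 0) (a : Fin n → A) :
    φ (List.ofFn a).prod = ∑ π ∈ NC n, ∏ V ∈ π.parts,
      freeCumulant φ V.card (fun i => a (V.orderEmbOfFin rfl i)) := by
  have hne : (Finset.univ : Finset (Fin n)).Nonempty := ⟨⟨0, Nat.pos_of_ne_zero hn⟩, by simp⟩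
  have htop : ∀ π : Part n, Finset.univ ∈ π.parts → π.parts = {Finset.univ} := by
    intro π hu
    refine Finset.eq_singleton_iff_unique_mem.2 ⟨hu, fun V hV => ?_⟩
    obtain ⟨i, hi⟩ := π.nonempty_of_mem_parts hV
    exact π.eq_of_mem_parts hV hu hi (Finset.mem_univ i)
  have huniv : ∀ (m : ℕ) (hm : (Finset.univ : Finset (Fin n)).card = m),
      freeCumulant φ m (fun i => a (Finset.univ.orderEmbOfFin hm i)) = freeCumulant φ n a := by
    intro m hm
    obtain rfl : n = m := by simpa using hm
    have h := Finset.orderEmbOfFin_unique hm (f := id) (fun _ => Finset.mem_univ _) strictMono_id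
    rw [← h]
    rfl
  let T : Part n := Finpartition.indiscrete hne.ne_empty
  have hT : (NC n).filter (fun π => ¬ Finset.univ ∉ π.parts) = {T} := by
    refine Finset.eq_singleton_iff_unique_mem.2 ⟨?_, ?_⟩
    · simp only [NC, Finset.mem_filter, Finset.mem_univ, true_and, not_not]
      have hTu : Finset.univ ∈ T.parts := by simp [T]
      exact ⟨fun _ _ _ _ _ _ _ _ _ => ⟨_, hTu, by simp, by simp⟩, hTu⟩
    · intro π hπ
      have h := (Finset.mem_filter.1 hπ).2
      exact Finpartition.ext ((htop π (not_not.1 h)).trans (by simp [T]))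
  rw [← Finset.sum_filter_add_sum_filter_not (NC n) (fun π => Finset.univ ∉ π.parts), hT,
    Finset.sum_singleton, show T.parts = {Finset.univ} by simp [T], Finset.prod_singleton, huniv,
    ← sub_eq_iff_eq_add']
  conv_rhs => rw [freeCumulant]
  congr 1
  refine Finset.sum_congr rfl fun π hπ => ?_
  rw [← Finset.prod_attach π.parts]
  refine Finset.prod_congr rfl fun V _ => ?_
  have hV : V.1.card < n := by
    have h1 : V.1 ≠ Finset.univ := fun h => by
      have h2 := V.2
      rw [h] at h2
      exact (Finset.mem_filter.1 hπ).2 h2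
    simpa using Finset.card_lt_card (Finset.ssubset_univ_iff.2 h1)
  rw [dif_pos hV]

/-- The moment series `∑_{n ≥ 1} φ(aⁿ) zⁿ`. -/
noncomputable def momentSeries (φ : A → R) (a : A) : M1 R :=
  ⟨PowerSeries.mk fun n => if n = 0 then 0 else φ (a ^ n), by
    rw [← coeff_zero_eq_constantCoeff_apply, coeff_mk, if_pos rfl]⟩

/-- The `R`-transform `∑_{n ≥ 1} κₙ(a, …, a) zⁿ`. -/
noncomputable def cumulantSeries (φ : A → R) (a : A) : M1 R :=
  ⟨PowerSeries.mk fun n => if n = 0 then 0 else freeCumulant φ n (fun _ => a), by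
    rw [← coeff_zero_eq_constantCoeff_apply, coeff_mk, if_pos rfl]⟩

end Prob

/-! ### Abelian groups given by explicit operations -/

/-- `op` is the operation of an abelian group with neutral element `e`. -/
structure IsAbelianGroup {α : Type*} (op : α → α → α) (e : α) : Prop where
  assoc : ∀ a b c, op (op a b) c = op a (op b c)
  comm : ∀ a b, op a b = op b a
  id_left : ∀ a, op e a = a
  inv_left : ∀ a, ∃ b, op b a = e

/-- `f` is a bijection which carries the operation `opA` to `opB`. -/
structure IsGroupIso {α β : Type*} (opA : α → α → α) (opB : β → β → β) (f : α → β) : Prop where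
  bijective : Function.Bijective f
  map_op : ∀ a b, f (opA a b) = opB (f a) (f b)

end FreeConv

namespace FreeConv

/-! ### Splitting a partition at the last point of its first block -/

section Split

/-! The combinatorial core is a Catalan recursion. Cutting a non-crossing partition of n + 1 points
at the last point c of the block of the first point leaves arbitrary non-crossing partitions π and σ
of the points before and after c. The block of the first point is that of π enlarged by c; in the
Kreweras complement, K(π) survives unchanged and c̄ joins the last block of K(σ). Sums over NC(n) in
which these two blocks carry weights of their own therefore satisfy a recursion (`markedSum_succ`),
and their generating functions are substitutions: there are h, k with h = z·(g/z)(k), k = z·(f/z)(h)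
and f ⊠ g = f(h) = g(k) (`box_eq_subst`).

For u = f ⊠ g in 𝔊¹₊ this says h = f⁻¹(u), k = g⁻¹(u) and hk = zu, hence F(u) = F(f)F(g) (`FT_box`);
as F is bijective, ⊠ is an abelian group law. A general f in 𝔐¹ has no F-transform, but h is the
unique solution without constant term of h·F(g)(f(h)) = z, so 𝔊¹₊ acts on 𝔐¹ from the right
(`box_box`) and ⊠ Zeta is bijective there too.

S_V is F after ⊠ Moeb, because F(Zeta) = 1/(1 + z), and d/dz log is inverted by exponentials of
antiderivatives (`dlog_bijective`). The remaining groups and isomorphisms arise by transport and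
composition. Naturality rests on the uniqueness of the inverses involved, and M(a) = R(a) ⊠ Zeta is
the moment-cumulant formula, since Zeta gives every block weight 1. -/

lemma SameBlock.refl {n : ℕ} (π : Part n) (i : Fin n) : SameBlock π i i :=
  (sameBlock_iff π i i).2 (π.mem_part (Finset.mem_univ i))

lemma SameBlock.trans {n : ℕ} {π : Part n} {i j k : Fin n} (h : SameBlock π i j)
    (h' : SameBlock π j k) : SameBlock π i k := by
  obtain ⟨V, hV, hi, hj⟩ := h
  obtain ⟨W, hW, hj', hk⟩ := h'
  obtain rfl := π.eq_of_mem_parts hV hW hj hj'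
  exact ⟨V, hV, hi, hk⟩

lemma part_ext {n : ℕ} {σ τ : Part n} (h : ∀ i j, SameBlock σ i j ↔ SameBlock τ i j) : σ = τ :=
  le_antisymm ((part_le_iff _ _).2 fun i j => (h i j).1) ((part_le_iff _ _).2 fun i j => (h i j).2)

lemma mem_parts_iff {n : ℕ} (π : Part n) (V : Finset (Fin n)) :
    V ∈ π.parts ↔ ∃ i, V = π.part i := by
  constructor
  · intro hV
    obtain ⟨i, hi⟩ := π.nonempty_of_mem_parts hV
    exact ⟨i, (π.part_eq_of_mem hV hi).symm⟩
  · rintro ⟨i, rfl⟩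
    exact π.part_mem.2 (Finset.mem_univ i)

lemma mem_part_iff {n : ℕ} (π : Part n) (i j : Fin n) : i ∈ π.part j ↔ SameBlock π j i :=
  (sameBlock_iff _ _ _).symm.trans ⟨SameBlock.symm, SameBlock.symm⟩

lemma part_eq_part_iff {n : ℕ} (π : Part n) (i j : Fin n) :
    π.part i = π.part j ↔ SameBlock π i j := by
  rw [sameBlock_iff]
  exact ⟨fun h => h ▸ π.mem_part (Finset.mem_univ i),
    fun h => π.part_eq_of_mem (π.part_mem.2 (Finset.mem_univ j)) h⟩

/-- The block of the first point, empty if there are no points. -/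
def firstBlock {n : ℕ} (π : Part n) : Finset (Fin n) :=
  {j | ∃ i : Fin n, i.val = 0 ∧ SameBlock π i j}

/-- The block of the last point, empty if there are no points. -/
def lastBlock {n : ℕ} (π : Part n) : Finset (Fin n) :=
  {j | ∃ i : Fin n, i.val + 1 = n ∧ SameBlock π i j}

lemma firstBlock_mem {n : ℕ} (π : Part n) : firstBlock π ∈ π.parts ∨ firstBlock π = ∅ := by
  rcases n with _ | n
  · exact Or.inr (Finset.eq_empty_of_isEmpty _)
  · refine Or.inl ((mem_parts_iff _ _).2 ⟨0, ?_⟩)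
    ext j
    simp only [firstBlock, Finset.mem_filter, Finset.mem_univ, true_and, mem_part_iff]
    exact ⟨fun ⟨i, hi, h⟩ => (Fin.ext hi : i = 0) ▸ h, fun h => ⟨0, rfl, h⟩⟩

lemma lastBlock_mem {n : ℕ} (π : Part n) : lastBlock π ∈ π.parts ∨ lastBlock π = ∅ := by
  rcases n with _ | n
  · exact Or.inr (Finset.eq_empty_of_isEmpty _)
  · refine Or.inl ((mem_parts_iff _ _).2 ⟨Fin.last n, ?_⟩)
    ext j
    simp only [lastBlock, Finset.mem_filter, Finset.mem_univ, true_and, mem_part_iff]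
    exact ⟨fun ⟨i, hi, h⟩ => (Fin.ext (by simpa using hi) : i = Fin.last n) ▸ h,
      fun h => ⟨Fin.last n, by simp, h⟩⟩

/-! ### Weights of partitions with one distinguished block -/

section Weights

variable {R : Type*} [CommRing R]

/-- The product of the weights of all blocks. -/
def blockWeight {n : ℕ} (w : ℕ → R) (π : Part n) : R := ∏ V ∈ π.parts, w V.card

/-- The product of the weights of all blocks, with `B` carrying the weight `p` instead of `w`. -/
def markedWeight {n : ℕ} (w p : ℕ → R) (π : Part n) (B : Finset (Fin n)) : R :=
  p B.card * ∏ V ∈ π.parts.erase B, w V.card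

/-- An empty B is not a block, so erasing it changes nothing and its factor is w 0 = 1. -/
lemma markedWeight_self {n : ℕ} {w : ℕ → R} (hw : w 0 = 1) {π : Part n} {B : Finset (Fin n)}
    (hB : B ∈ π.parts ∨ B = ∅) : markedWeight w w π B = blockWeight w π := by
  rcases hB with hB | rfl
  · exact Finset.mul_prod_erase _ (fun V : Finset (Fin n) => w V.card) hB
  · rw [markedWeight, Finset.card_empty, hw, one_mul, Finset.erase_eq_of_notMem, blockWeight]
    exact π.bot_notMem

/-- The blocks of ρ are the block of c, which is c together with the copy of B, the copies of the
blocks of σ other than B, and the copies of the blocks of τ. The weight p is shifted because c adds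
one point to B. The embeddings are abstract because the lemma serves both a glued partition and its
complement, where the halves exchange roles. -/
lemma markedWeight_split {N v m : ℕ} {ρ : Part N} {σ : Part v} {τ : Part m}
    (e₁ : Fin v ↪ Fin N) (e₂ : Fin m ↪ Fin N) (c : Fin N) (B : Finset (Fin v))
    (hcov : ∀ x, x = c ∨ (∃ a, x = e₁ a) ∨ ∃ b, x = e₂ b) (hc : ∀ a, c ≠ e₁ a)
    (h₁₁ : ∀ a b, SameBlock ρ (e₁ a) (e₁ b) ↔ SameBlock σ a b)
    (h₂₂ : ∀ a b, SameBlock ρ (e₂ a) (e₂ b) ↔ SameBlock τ a b)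
    (hc₁ : ∀ a, SameBlock ρ c (e₁ a) ↔ a ∈ B) (hc₂ : ∀ b, ¬ SameBlock ρ c (e₂ b))
    (h₁₂ : ∀ a b, ¬ SameBlock ρ (e₁ a) (e₂ b)) (w p : ℕ → R) :
    markedWeight w p ρ (ρ.part c) =
      markedWeight w (fun k => p (k + 1)) σ B * blockWeight w τ := by
  have hpart : ρ.part c = insert c (B.map e₁) := by
    ext x
    rw [mem_part_iff, Finset.mem_insert, Finset.mem_map]
    rcases hcov x with rfl | ⟨a, rfl⟩ | ⟨b, rfl⟩
    · simp [SameBlock.refl]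
    · simp [hc₁, (hc a).symm]
    · simp only [hc₂, false_iff, not_or, not_exists, not_and]
      refine ⟨fun h => hc₂ b (h ▸ SameBlock.refl _ _), fun a _ h => h₁₂ a b (h ▸ SameBlock.refl _ _)⟩
  have hcard : (ρ.part c).card = B.card + 1 := by
    rw [hpart, Finset.card_insert_of_notMem, Finset.card_map]
    simpa using fun a _ => (hc a).symm
  have h1 : ∀ a, a ∉ B → ρ.part (e₁ a) = (σ.part a).map e₁ := by
    intro a ha
    ext x
    rw [mem_part_iff, Finset.mem_map]
    rcases hcov x with rfl | ⟨b, rfl⟩ | ⟨b, rfl⟩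
    · exact ⟨fun h => absurd ((hc₁ a).1 h.symm) ha, fun ⟨b, _, h⟩ => absurd h.symm (hc b)⟩
    · simp [h₁₁, mem_part_iff]
    · exact ⟨fun h => absurd h (h₁₂ a b),
        fun ⟨a', _, h⟩ => absurd (h ▸ SameBlock.refl _ _) (h₁₂ a' b)⟩
  have h2 : ∀ b, ρ.part (e₂ b) = (τ.part b).map e₂ := by
    intro b
    ext x
    rw [mem_part_iff, Finset.mem_map]
    rcases hcov x with rfl | ⟨a, rfl⟩ | ⟨a, rfl⟩
    · exact ⟨fun h => absurd h.symm (hc₂ b),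
        fun ⟨b', _, h⟩ => absurd (h ▸ SameBlock.refl _ _) (hc₂ b')⟩
    · exact ⟨fun h => absurd h.symm (h₁₂ a b),
        fun ⟨b', _, h⟩ => absurd (h ▸ SameBlock.refl _ _) (h₁₂ a b')⟩
    · simp [h₂₂, mem_part_iff]
  -- Unless it is empty, B is a block of σ; this follows from `hc₁` and `h₁₁`.
  have hB : ∀ a ∈ B, σ.part a = B := by
    intro a ha
    ext b
    rw [mem_part_iff, ← h₁₁, ← hc₁]
    exact ⟨((hc₁ a).2 ha).trans, ((hc₁ a).2 ha).symm.trans⟩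
  have hparts : ρ.parts.erase (ρ.part c) = (σ.parts.erase B).map (Finset.mapEmbedding e₁).toEmbedding ∪
      τ.parts.map (Finset.mapEmbedding e₂).toEmbedding := by
    ext V
    simp only [Finset.mem_erase, Finset.mem_union, Finset.mem_map, mem_parts_iff,
      RelEmbedding.coe_toEmbedding, Finset.mapEmbedding_apply]
    constructor
    · rintro ⟨hV, x, rfl⟩
      rcases hcov x with rfl | ⟨a, rfl⟩ | ⟨b, rfl⟩
      · exact absurd rfl hV
      · have ha : a ∉ B := fun ha => hV ((part_eq_part_iff _ _ _).2 ((hc₁ a).2 ha).symm)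
        refine Or.inl ⟨σ.part a, ⟨fun h => ha ?_, a, rfl⟩, (h1 a ha).symm⟩
        rw [← h, mem_part_iff]
        exact SameBlock.refl _ _
      · exact Or.inr ⟨_, ⟨b, rfl⟩, (h2 b).symm⟩
    · rintro (⟨_, ⟨hV, a, rfl⟩, rfl⟩ | ⟨_, ⟨b, rfl⟩, rfl⟩)
      · have ha : a ∉ B := fun ha => hV (hB a ha)
        exact ⟨fun h => ha ((hc₁ a).1 ((part_eq_part_iff _ _ _).1 ((h1 a ha).trans h)).symm),
          _, (h1 a ha).symm⟩
      · exact ⟨fun h => hc₂ b ((part_eq_part_iff _ _ _).1 ((h2 b).trans h)).symm, _, (h2 b).symm⟩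
  rw [markedWeight, markedWeight, blockWeight, hcard, hparts, Finset.prod_union, Finset.prod_map,
    Finset.prod_map, mul_assoc]
  · simp
  · rw [Finset.disjoint_left]
    simp only [Finset.mem_erase, Finset.mem_map, mem_parts_iff,
      RelEmbedding.coe_toEmbedding, Finset.mapEmbedding_apply]
    rintro _ ⟨_, ⟨_, a, rfl⟩, rfl⟩ ⟨_, ⟨b, rfl⟩, h⟩
    have : e₂ b ∈ (σ.part a).map e₁ := h ▸ Finset.mem_map_of_mem _ (τ.mem_part (Finset.mem_univ b))
    obtain ⟨a', _, h'⟩ := Finset.mem_map.1 this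
    exact h₁₂ a' b (h' ▸ SameBlock.refl _ _)

end Weights

/-! ### Gluing two partitions at a cut point -/

section Glue

variable {n v m : ℕ}

/-- The points before the cut. -/
def leftEmb (h : v + m = n) : Fin v ↪ Fin (n + 1) :=
  ⟨fun a => ⟨a, by omega⟩, fun a b hab => Fin.ext (by simpa using hab)⟩

/-- The point at which a partition is cut. -/
def cut (h : v + m = n) : Fin (n + 1) := ⟨v, by omega⟩

/-- The points after the cut. -/
def rightEmb (h : v + m = n) : Fin m ↪ Fin (n + 1) :=
  ⟨fun b => ⟨v + 1 + b, by omega⟩, fun a b hab => Fin.ext (by simpa using hab)⟩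

@[simp] lemma leftEmb_val (h : v + m = n) (a : Fin v) : (leftEmb h a).val = a := rfl
@[simp] lemma cut_val (h : v + m = n) : (cut h).val = v := rfl
@[simp] lemma rightEmb_val (h : v + m = n) (b : Fin m) : (rightEmb h b).val = v + 1 + b := rfl

lemma cut_cases (h : v + m = n) (x : Fin (n + 1)) :
    x = cut h ∨ (∃ a, x = leftEmb h a) ∨ ∃ b, x = rightEmb h b := by
  rcases lt_trichotomy x.val v with hx | hx | hx
  · exact Or.inr (Or.inl ⟨⟨x, hx⟩, rfl⟩)
  · exact Or.inl (Fin.ext hx)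
  · exact Or.inr (Or.inr ⟨⟨x - (v + 1), by omega⟩, Fin.ext (by simp; omega)⟩)

/-- The label of a point: its block in one of the two parts, where the cut belongs to the first
block of the left part. -/
def glueLabel (π : Part v) (σ : Part m) (h : v + m = n) (x : Fin (n + 1)) :
    Finset (Fin v) ⊕ Finset (Fin m) :=
  if hx : x.val < v then .inl (π.part ⟨x, hx⟩)
  else if hx' : x.val = v then .inl (firstBlock π)
  else .inr (σ.part ⟨x - (v + 1), by omega⟩)

/-- The partition formed from `π` and `σ`, where the cut is added to the first block of `π`. -/
def glue (π : Part v) (σ : Part m) (h : v + m = n) : Part (n + 1) :=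
  letI : DecidableRel (Setoid.ker (glueLabel π σ h)).r := fun x y =>
    inferInstanceAs (Decidable (glueLabel π σ h x = glueLabel π σ h y))
  Finpartition.ofSetoid (Setoid.ker (glueLabel π σ h))

variable (π : Part v) (σ : Part m) (h : v + m = n)

lemma sameBlock_glue (x y : Fin (n + 1)) :
    SameBlock (glue π σ h) x y ↔ glueLabel π σ h x = glueLabel π σ h y := by
  let : DecidableRel (Setoid.ker (glueLabel π σ h)).r := fun x y =>
    inferInstanceAs (Decidable (glueLabel π σ h x = glueLabel π σ h y))
  rw [← part_eq_part_iff, part_eq_part_iff]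
  have : SameBlock (glue π σ h) y x ↔ (Setoid.ker (glueLabel π σ h)) x y :=
    (sameBlock_iff _ _ _).trans Finpartition.mem_part_ofSetoid_iff_rel
  exact ⟨fun hh => this.1 hh.symm, fun hh => (this.2 hh).symm⟩

lemma glueLabel_left (a : Fin v) : glueLabel π σ h (leftEmb h a) = .inl (π.part a) := by
  simp [glueLabel]

lemma glueLabel_cut : glueLabel π σ h (cut h) = .inl (firstBlock π) := by
  simp [glueLabel]

lemma glueLabel_right (b : Fin m) : glueLabel π σ h (rightEmb h b) = .inr (σ.part b) := by
  have : ¬ (v + 1 + b.val < v) := by omega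
  have h' : ¬ (v + 1 + b.val = v) := by omega
  simp [glueLabel, this, h']

@[simp] lemma glue_left_left (a b : Fin v) :
    SameBlock (glue π σ h) (leftEmb h a) (leftEmb h b) ↔ SameBlock π a b := by
  simp [sameBlock_glue, glueLabel_left, part_eq_part_iff]

@[simp] lemma glue_right_right (a b : Fin m) :
    SameBlock (glue π σ h) (rightEmb h a) (rightEmb h b) ↔ SameBlock σ a b := by
  simp [sameBlock_glue, glueLabel_right, part_eq_part_iff]

@[simp] lemma glue_cut_left (a : Fin v) :
    SameBlock (glue π σ h) (cut h) (leftEmb h a) ↔ a ∈ firstBlock π := by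
  rw [sameBlock_glue, glueLabel_left, glueLabel_cut, Sum.inl.injEq]
  constructor
  · rintro h
    rw [h]
    exact π.mem_part (Finset.mem_univ a)
  · intro ha
    rcases firstBlock_mem π with hB | hB
    · exact (π.part_eq_of_mem hB ha).symm
    · simp [hB] at ha

@[simp] lemma glue_left_cut (a : Fin v) :
    SameBlock (glue π σ h) (leftEmb h a) (cut h) ↔ a ∈ firstBlock π := by
  rw [← glue_cut_left π σ h]
  exact ⟨SameBlock.symm, SameBlock.symm⟩

@[simp] lemma glue_cut_right (b : Fin m) :
    ¬ SameBlock (glue π σ h) (cut h) (rightEmb h b) := by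
  simp [sameBlock_glue, glueLabel_right, glueLabel_cut]

@[simp] lemma glue_right_cut (b : Fin m) :
    ¬ SameBlock (glue π σ h) (rightEmb h b) (cut h) := by
  simp [sameBlock_glue, glueLabel_right, glueLabel_cut]

@[simp] lemma glue_left_right (a : Fin v) (b : Fin m) :
    ¬ SameBlock (glue π σ h) (leftEmb h a) (rightEmb h b) := by
  simp [sameBlock_glue, glueLabel_right, glueLabel_left]

@[simp] lemma glue_right_left (a : Fin v) (b : Fin m) :
    ¬ SameBlock (glue π σ h) (rightEmb h b) (leftEmb h a) := by
  simp [sameBlock_glue, glueLabel_right, glueLabel_left]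

lemma mem_firstBlock {n : ℕ} (π : Part n) (j : Fin n) :
    j ∈ firstBlock π ↔ ∃ i : Fin n, i.val = 0 ∧ SameBlock π i j := by
  simp [firstBlock]

lemma mem_lastBlock {n : ℕ} (π : Part n) (j : Fin n) :
    j ∈ lastBlock π ↔ ∃ i : Fin n, i.val + 1 = n ∧ SameBlock π i j := by
  simp [lastBlock]

/-- If the left half is empty, the cut is itself the first point. -/
lemma glue_zero_cut : SameBlock (glue π σ h) 0 (cut h) := by
  rcases v with _ | v
  · exact SameBlock.refl _ _
  · exact (glue_left_cut π σ h 0).2 ((mem_firstBlock _ _).2 ⟨0, rfl, SameBlock.refl _ _⟩)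

lemma firstBlock_glue : firstBlock (glue π σ h) = (glue π σ h).part (cut h) := by
  ext j
  rw [mem_firstBlock, mem_part_iff]
  constructor
  · rintro ⟨i, hi, hij⟩
    obtain rfl : i = 0 := Fin.ext hi
    exact (glue_zero_cut π σ h).symm.trans hij
  · exact fun hj => ⟨0, rfl, (glue_zero_cut π σ h).trans hj⟩

end Glue
end Split

/-! ### The Catalan recursion for non-crossing partitions and their complements -/

section Catalan

variable {n v m : ℕ} (π : Part v) (σ : Part m) (h : v + m = n)

/-- Blocks in the right half lie outside the arc from ā to b̄, so only the cut, added to the first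
block of π, could impose a new condition. -/
lemma kreweras_glue_left_left (a b : Fin v) :
    SameBlock (kreweras (glue π σ h)) (leftEmb h a) (leftEmb h b) ↔
      SameBlock (kreweras π) a b := by
  rw [sameBlock_kreweras, sameBlock_kreweras]
  constructor
  · intro H x y hxy
    have := H _ _ ((glue_left_left π σ h x y).2 hxy)
    simpa only [Fin.lt_def, leftEmb_val] using this
  -- The first point is before both ā and b̄. Hence a first block not separated by them has no point
  -- between them, and adding the cut, which is after both, does no harm.
  · have key : (∀ x y, SameBlock π x y → ((a < x ↔ b < x) ↔ (a < y ↔ b < y))) →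
        ∀ x, x ∈ firstBlock π → (a < x ↔ b < x) := by
      intro H x hx
      obtain ⟨i, hi, hix⟩ := (mem_firstBlock _ _).1 hx
      have := H _ _ hix
      simp only [Fin.lt_def, hi] at this ⊢
      omega
    intro H x y hxy
    have key := key H
    rcases cut_cases h x with rfl | ⟨x, rfl⟩ | ⟨x, rfl⟩ <;>
    rcases cut_cases h y with rfl | ⟨y, rfl⟩ | ⟨y, rfl⟩ <;>
    try simp only [glue_left_left, glue_cut_left, glue_left_cut, glue_cut_right, glue_right_cut,
      glue_left_right, glue_right_left, glue_right_right] at hxy <;>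
    try have := key _ hxy
    all_goals try have := H _ _ hxy
    all_goals simp only [Fin.lt_def, leftEmb_val, cut_val, rightEmb_val] at *
    all_goals omega

lemma kreweras_glue_right_right (a b : Fin m) :
    SameBlock (kreweras (glue π σ h)) (rightEmb h a) (rightEmb h b) ↔
      SameBlock (kreweras σ) a b := by
  rw [sameBlock_kreweras, sameBlock_kreweras]
  constructor
  · intro H x y hxy
    have := H _ _ ((glue_right_right π σ h x y).2 hxy)
    simpa only [Fin.lt_def, rightEmb_val, add_lt_add_iff_left] using this
  · intro H x y hxy
    rcases cut_cases h x with rfl | ⟨x, rfl⟩ | ⟨x, rfl⟩ <;>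
    rcases cut_cases h y with rfl | ⟨y, rfl⟩ | ⟨y, rfl⟩ <;>
    try simp only [glue_left_left, glue_cut_left, glue_left_cut, glue_cut_right, glue_right_cut,
      glue_left_right, glue_right_left, glue_right_right] at hxy <;>
    try have := H _ _ hxy
    all_goals simp only [Fin.lt_def, leftEmb_val, cut_val, rightEmb_val] at *
    all_goals omega

/-- Among the points of the right half, the arc from c̄ to b̄ and the arc from b̄ to the last barred
point are complementary, so they separate the same blocks of σ. The other blocks lie entirely before
c̄. -/
lemma kreweras_glue_cut_right (b : Fin m) :
    SameBlock (kreweras (glue π σ h)) (cut h) (rightEmb h b) ↔ b ∈ lastBlock (kreweras σ) := by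
  rw [sameBlock_kreweras, mem_lastBlock]
  constructor
  · intro H
    refine ⟨⟨m - 1, by have := b.2; omega⟩, by have := b.2; simp only; omega, ?_⟩
    rw [sameBlock_kreweras]
    intro x y hxy
    have := H _ _ ((glue_right_right π σ h x y).2 hxy)
    simp only [Fin.lt_def, cut_val, rightEmb_val] at this ⊢
    omega
  · rintro ⟨i, hi, H⟩ x y hxy
    rw [sameBlock_kreweras] at H
    rcases cut_cases h x with rfl | ⟨x, rfl⟩ | ⟨x, rfl⟩ <;>
    rcases cut_cases h y with rfl | ⟨y, rfl⟩ | ⟨y, rfl⟩ <;>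
    try simp only [glue_left_left, glue_cut_left, glue_left_cut, glue_cut_right, glue_right_cut,
      glue_left_right, glue_right_left, glue_right_right] at hxy <;>
    try have := H _ _ hxy
    all_goals simp only [Fin.lt_def, leftEmb_val, cut_val, rightEmb_val] at *
    all_goals omega

/-- The block through the first point and the cut is separated: the cut lies between ā and c̄, the
first point does not. -/
lemma kreweras_glue_cut_left (a : Fin v) :
    ¬ SameBlock (kreweras (glue π σ h)) (cut h) (leftEmb h a) := by
  rw [sameBlock_kreweras]
  intro H
  have := H _ _ (glue_zero_cut π σ h)
  simp only [Fin.lt_def, leftEmb_val, cut_val, Fin.val_zero] at this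
  omega

lemma kreweras_glue_right_left (b : Fin m) (a : Fin v) :
    ¬ SameBlock (kreweras (glue π σ h)) (rightEmb h b) (leftEmb h a) := by
  rw [sameBlock_kreweras]
  intro H
  have := H _ _ (glue_zero_cut π σ h)
  simp only [Fin.lt_def, leftEmb_val, cut_val, rightEmb_val, Fin.val_zero] at this
  omega

/-- The last barred point is c̄ itself if the right half is empty, and otherwise lies in the block
that c̄ joins. -/
lemma lastBlock_kreweras_glue :
    lastBlock (kreweras (glue π σ h)) = (kreweras (glue π σ h)).part (cut h) := by
  have hlast : ∀ i : Fin (n + 1), i.val + 1 = n + 1 →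
      SameBlock (kreweras (glue π σ h)) (cut h) i := by
    intro i hi
    rcases cut_cases h i with rfl | ⟨a, rfl⟩ | ⟨b, rfl⟩
    · exact SameBlock.refl _ _
    · simp only [leftEmb_val] at hi
      omega
    · simp only [rightEmb_val] at hi
      exact (kreweras_glue_cut_right π σ h b).2
        ((mem_lastBlock _ _).2 ⟨b, by omega, SameBlock.refl _ _⟩)
  ext j
  rw [mem_lastBlock, mem_part_iff]
  constructor
  · rintro ⟨i, hi, hij⟩
    exact (hlast i hi).trans hij
  · exact fun hj => ⟨Fin.last n, by simp, (hlast _ (by simp)).symm.trans hj⟩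

section Weights

variable {R : Type*} [CommRing R]

lemma markedWeight_firstBlock_glue (w p : ℕ → R) :
    markedWeight w p (glue π σ h) (firstBlock (glue π σ h)) =
      markedWeight w (fun k => p (k + 1)) π (firstBlock π) * blockWeight w σ := by
  rw [firstBlock_glue]
  exact markedWeight_split (leftEmb h) (rightEmb h) (cut h) (firstBlock π) (cut_cases h)
    (fun a e => by have := congrArg Fin.val e; simp at this; omega)
    (glue_left_left π σ h) (glue_right_right π σ h) (glue_cut_left π σ h) (glue_cut_right π σ h)
    (glue_left_right π σ h) w p

/-- In the complement the halves exchange roles: the cut now enlarges a block of the right half. -/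
lemma markedWeight_lastBlock_kreweras_glue (w p : ℕ → R) :
    markedWeight w p (kreweras (glue π σ h)) (lastBlock (kreweras (glue π σ h))) =
      markedWeight w (fun k => p (k + 1)) (kreweras σ) (lastBlock (kreweras σ)) *
        blockWeight w (kreweras π) := by
  rw [lastBlock_kreweras_glue]
  exact markedWeight_split (rightEmb h) (leftEmb h) (cut h) (lastBlock (kreweras σ))
    (fun x => (cut_cases h x).imp_right Or.symm)
    (fun a e => by have := congrArg Fin.val e; simp at this; omega)
    (kreweras_glue_right_right π σ h) (kreweras_glue_left_left π σ h)
    (kreweras_glue_cut_right π σ h) (kreweras_glue_cut_left π σ h)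
    (kreweras_glue_right_left π σ h) w p

end Weights

lemma mem_NC {n : ℕ} {π : Part n} : π ∈ NC n ↔ NonCrossing (SameBlock π) := by
  simp [NC]

variable {π σ} in
lemma glue_mem_NC (hπ : π ∈ NC v) (hσ : σ ∈ NC m) : glue π σ h ∈ NC (n + 1) := by
  rw [mem_NC] at *
  -- Only the first block grows, so a new crossing would have the cut as its last point. If q is in
  -- the first block and p < q < r with p ∼ r, then π itself, with its first point, already forces q
  -- ∼ r.
  have hfirst : ∀ p q r : Fin v, p < q → q < r → SameBlock π p r → q ∈ firstBlock π →
      SameBlock π q r := by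
    intro p q r hpq hqr hpr hq
    obtain ⟨i, hi, hiq⟩ := (mem_firstBlock _ _).1 hq
    have hip : i ≤ p := by rw [Fin.le_def]; omega
    rcases hip.eq_or_lt with rfl | hip
    · exact hiq.symm.trans hpr
    · exact (hπ i p q r hip hpq hqr hiq hpr).symm.trans hpr
  intro p₁ q₁ p₂ q₂ h₁ h₂ h₃ hp hq
  rcases cut_cases h p₁ with rfl | ⟨p₁, rfl⟩ | ⟨p₁, rfl⟩ <;>
  rcases cut_cases h p₂ with rfl | ⟨p₂, rfl⟩ | ⟨p₂, rfl⟩ <;>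
  rcases cut_cases h q₁ with rfl | ⟨q₁, rfl⟩ | ⟨q₁, rfl⟩ <;>
  rcases cut_cases h q₂ with rfl | ⟨q₂, rfl⟩ | ⟨q₂, rfl⟩
  all_goals simp only [Fin.lt_def, leftEmb_val, cut_val, rightEmb_val] at h₁ h₂ h₃
  all_goals try omega
  all_goals simp only [glue_left_left, glue_left_cut, glue_cut_right, glue_left_right,
    glue_right_right] at hp hq ⊢
  · exact hfirst _ _ _ h₁ h₂ hp hq
  · exact hπ _ _ _ _ h₁ h₂ h₃ hp hq
  · exact hσ p₁ q₁ p₂ q₂ (by rw [Fin.lt_def]; omega) (by rw [Fin.lt_def]; omega)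
      (by rw [Fin.lt_def]; omega) hp hq

lemma le_of_zero_glue {x : Fin (n + 1)} (hx : SameBlock (glue π σ h) 0 x) : x ≤ cut h := by
  have hx := (glue_zero_cut π σ h).symm.trans hx
  rcases cut_cases h x with rfl | ⟨a, rfl⟩ | ⟨b, rfl⟩
  · exact le_rfl
  · rw [Fin.le_def, leftEmb_val, cut_val]
    omega
  · exact absurd hx (glue_cut_right π σ h b)

/-- The cut is the largest element of the block of the first point; π and σ are the restrictions of
ρ to the two sides. -/
lemma exists_glue {ρ : Part (n + 1)} (hρ : ρ ∈ NC (n + 1)) :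
    ∃ (v : Fin (n + 1)) (π : Part v) (σ : Part (n - v)),
      π ∈ NC v ∧ σ ∈ NC (n - v) ∧ glue π σ (Nat.add_sub_of_le v.is_le) = ρ := by
  rw [mem_NC] at hρ
  have hne : (ρ.part 0).Nonempty := ⟨0, ρ.mem_part (Finset.mem_univ 0)⟩
  set c := (ρ.part 0).max' hne with hc
  have h0c : SameBlock ρ 0 c := (mem_part_iff _ _ _).1 ((ρ.part 0).max'_mem hne)
  have hmax : ∀ x, SameBlock ρ 0 x → x ≤ c := fun x hx =>
    (ρ.part 0).le_max' _ ((mem_part_iff _ _ _).2 hx)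
  clear_value c
  have h : c.val + (n - c) = n := Nat.add_sub_of_le c.is_le
  have hcut : cut h = c := rfl
  have comap : ∀ (k : ℕ) (e : Fin k ↪ Fin (n + 1)), StrictMono e →
      ∃ τ : Part k, τ ∈ NC k ∧ ∀ a b, SameBlock τ a b ↔ SameBlock ρ (e a) (e b) := by
    intro k e he
    let s : Setoid (Fin k) := ⟨fun a b => SameBlock ρ (e a) (e b),
      ⟨fun _ => SameBlock.refl _ _, SameBlock.symm, SameBlock.trans⟩⟩
    let : DecidableRel s.r := fun a b => inferInstanceAs (Decidable (SameBlock ρ (e a) (e b)))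
    have hs : ∀ a b, SameBlock (Finpartition.ofSetoid s) a b ↔ SameBlock ρ (e a) (e b) := by
      intro a b
      have : SameBlock (Finpartition.ofSetoid s) b a ↔ s a b :=
        (sameBlock_iff _ _ _).trans Finpartition.mem_part_ofSetoid_iff_rel
      exact ⟨fun hh => this.1 hh.symm, fun hh => (this.2 hh).symm⟩
    refine ⟨Finpartition.ofSetoid s, mem_NC.2 fun p₁ q₁ p₂ q₂ h₁ h₂ h₃ hp hq => ?_, hs⟩
    rw [hs] at *
    exact hρ _ _ _ _ (he h₁) (he h₂) (he h₃) hp hq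
  obtain ⟨π, hπ, hπρ⟩ := comap _ (leftEmb h) fun a b hab => hab
  obtain ⟨σ, hσ, hσρ⟩ := comap _ (rightEmb h) fun a b hab => by
    rw [Fin.lt_def] at *
    simpa using hab
  have hcr : ∀ b, ¬ SameBlock ρ c (rightEmb h b) := by
    intro b hb
    have := hmax _ (h0c.trans hb)
    rw [Fin.le_def, rightEmb_val] at this
    omega
  -- A block joining both sides would cross the block of 0 and c, hence coincide with it, and so
  -- contradict the maximality of c.
  have hlr : ∀ a b, ¬ SameBlock ρ (leftEmb h a) (rightEmb h b) := by
    intro a b hab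
    rcases (Fin.zero_le (leftEmb h a)).eq_or_lt with h0 | h0
    · exact hcr b (h0c.symm.trans (h0 ▸ hab))
    · refine hcr b (SameBlock.trans (SameBlock.symm ?_) hab)
      refine hρ 0 (leftEmb h a) c (rightEmb h b) h0 ?_ ?_ h0c hab <;>
      rw [Fin.lt_def] <;> simp only [leftEmb_val, rightEmb_val] <;> omega
  have hlc : ∀ a, a ∈ firstBlock π ↔ SameBlock ρ (leftEmb h a) c := by
    intro a
    rw [mem_firstBlock]
    constructor
    · rintro ⟨i, hi, hia⟩
      have hi0 : leftEmb h i = 0 := Fin.ext hi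
      rw [hπρ, hi0] at hia
      exact hia.symm.trans h0c
    · intro ha
      refine ⟨⟨0, a.pos⟩, rfl, (hπρ _ _).2 ?_⟩
      exact h0c.trans ha.symm
  refine ⟨c, π, σ, hπ, hσ, part_ext fun x y => ?_⟩
  have hsymm : ∀ x y, SameBlock ρ x y ↔ SameBlock ρ y x :=
    fun x y => ⟨SameBlock.symm, SameBlock.symm⟩
  rcases cut_cases h x with rfl | ⟨x, rfl⟩ | ⟨x, rfl⟩ <;>
  rcases cut_cases h y with rfl | ⟨y, rfl⟩ | ⟨y, rfl⟩
  · simp [SameBlock.refl]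
  · rw [glue_cut_left, hlc, hcut, hsymm]
  · exact iff_of_false (glue_cut_right _ _ _ _) (hcr _)
  · rw [glue_left_cut, hlc, hcut]
  · rw [glue_left_left, hπρ]
  · exact iff_of_false (glue_left_right _ _ _ _ _) (hlr _ _)
  · exact iff_of_false (glue_right_cut _ _ _ _) (fun hh => hcr _ hh.symm)
  · exact iff_of_false (glue_right_left _ _ _ _ _) (fun hh => hlr _ _ hh.symm)
  · rw [glue_right_right, hσρ]

/-- The cut is recovered as the last point of the block of 0, and the two halves as restrictions, so
gluing is a bijection. -/
lemma sum_NC_succ {M : Type*} [AddCommMonoid M] (F : Part (n + 1) → M) :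
    ∑ ρ ∈ NC (n + 1), F ρ = ∑ v : Fin (n + 1), ∑ π ∈ NC v, ∑ σ ∈ NC (n - v),
      F (glue π σ (Nat.add_sub_of_le v.is_le)) := by
  simp_rw [← Finset.sum_product', Finset.sum_sigma']
  symm
  refine Finset.sum_bij (fun x _ => glue x.2.1 x.2.2 (Nat.add_sub_of_le x.1.is_le)) ?_ ?_ ?_ ?_
  · rintro ⟨v, π, σ⟩ hx
    simp only [Finset.mem_sigma, Finset.mem_univ, true_and, Finset.mem_product] at hx
    exact glue_mem_NC _ hx.1 hx.2
  · rintro ⟨v, π, σ⟩ - ⟨v', π', σ'⟩ - he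
    dsimp only at he
    have h := Nat.add_sub_of_le v.is_le
    have h' := Nat.add_sub_of_le v'.is_le
    obtain rfl : v = v' := le_antisymm
      (le_of_zero_glue π' σ' h' (he ▸ glue_zero_cut π σ h))
      (le_of_zero_glue π σ h (he ▸ glue_zero_cut π' σ' h'))
    obtain rfl : π = π' := part_ext fun a b => by
      rw [← glue_left_left π σ h, he, glue_left_left]
    obtain rfl : σ = σ' := part_ext fun a b => by
      rw [← glue_right_right π σ h, he, glue_right_right]
    rfl
  · intro ρ hρ
    obtain ⟨v, π, σ, hπ, hσ, he⟩ := exists_glue hρ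
    exact ⟨⟨v, π, σ⟩, by simp [hπ, hσ], he⟩
  · exact fun _ _ => rfl

/-! ### Sums over non-crossing partitions with two marked blocks -/

section Sums

variable {R : Type*} [CommRing R]

/-- The sum over the non-crossing partitions of the products of the weights `a` of the blocks
and `b` of the blocks of the complement, where the block of the first point has the weight `p`
and the block of the last point of the complement has the weight `q`. -/
noncomputable def markedSum (a b p q : ℕ → R) (n : ℕ) : R :=
  ∑ π ∈ NC n, markedWeight a p π (firstBlock π) *
    markedWeight b q (kreweras π) (lastBlock (kreweras π))

/-- Without points both marked blocks are empty, but their weights p 0 and q 0 still count. -/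
lemma markedSum_zero (a b p q : ℕ → R) : markedSum a b p q 0 = p 0 * q 0 := by
  have hNC : NC 0 = {⊤} := by
    refine Finset.eq_singleton_iff_unique_mem.2 ⟨mem_NC.2 fun i => i.elim0, fun π _ => ?_⟩
    exact part_ext fun i => i.elim0
  have hp : ∀ (π : Part 0) (B : Finset (Fin 0)) (w p : ℕ → R), markedWeight w p π B = p 0 := by
    intro π B w p
    have : π.parts = ∅ := by
      refine Finset.eq_empty_of_forall_notMem fun V hV => ?_
      obtain ⟨i, -⟩ := π.nonempty_of_mem_parts hV
      exact i.elim0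
    simp [markedWeight, this, Finset.eq_empty_of_isEmpty B]
  simp [markedSum, hNC, hp]

/-- The marked block of the partition falls into the left half and that of the complement into the
right half. The other two end blocks keep their ordinary weights; a 0 = b 0 = 1 allows them to be
counted as marked, even when empty. -/
lemma markedSum_succ {a b : ℕ → R} (ha : a 0 = 1) (hb : b 0 = 1) (p q : ℕ → R) (n : ℕ) :
    markedSum a b p q (n + 1) = ∑ ij ∈ Finset.HasAntidiagonal.antidiagonal n,
      markedSum a b (fun k => p (k + 1)) b ij.1 * markedSum a b a (fun k => q (k + 1)) ij.2 := by
  rw [Finset.Nat.sum_antidiagonal_eq_sum_range_succ (fun i j =>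
    markedSum a b (fun k => p (k + 1)) b i * markedSum a b a (fun k => q (k + 1)) j),
    Finset.sum_range, markedSum, sum_NC_succ]
  refine Finset.sum_congr rfl fun v _ => ?_
  rw [markedSum, markedSum, Finset.sum_mul_sum]
  refine Finset.sum_congr rfl fun π _ => Finset.sum_congr rfl fun σ _ => ?_
  rw [markedWeight_firstBlock_glue, markedWeight_lastBlock_kreweras_glue,
    markedWeight_self ha (firstBlock_mem σ), markedWeight_self hb (lastBlock_mem (kreweras π))]
  ring

lemma markedSum_self {a b : ℕ → R} (ha : a 0 = 1) (hb : b 0 = 1) (n : ℕ) :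
    markedSum a b a b n = ∑ π ∈ NC n, blockWeight a π * blockWeight b (kreweras π) := by
  refine Finset.sum_congr rfl fun π _ => ?_
  rw [markedWeight_self ha (firstBlock_mem π), markedWeight_self hb (lastBlock_mem (kreweras π))]

end Sums

end Catalan

/-! ### The functional equations of the boxed convolution -/

section Functional

variable {R : Type*} [CommRing R]

lemma eq_zero_of_X_pow_dvd {f : R⟦X⟧} (h : ∀ n, X ^ n ∣ f) : f = 0 := by
  ext n
  exact X_pow_dvd_iff.1 (h (n + 1)) n (Nat.lt_succ_self n)

lemma subst_eq_C_add {h f : R⟦X⟧} (hh : constantCoeff h = 0) :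
    f.subst h = C (constantCoeff f) + h * (divZ f).subst h := by
  have hs : HasSubst h := HasSubst.of_constantCoeff_zero' hh
  have hf : f = C (constantCoeff f) + X * divZ f := by
    ext n
    cases n with
    | zero => simp
    | succ n => simp [divZ, coeff_succ_X_mul]
  conv_lhs => rw [hf, subst_add hs, subst_mul hs, subst_X hs]
  congr 1
  exact subst_C _

lemma subst_eq_mul_divZ {h f : R⟦X⟧} (hh : constantCoeff h = 0) (hf : constantCoeff f = 0) :
    f.subst h = h * (divZ f).subst h := by
  rw [subst_eq_C_add hh, hf, map_zero, zero_add]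

/-- A family of power series indexed by power series, which satisfies the recursion of a
substitution, is a substitution. -/
lemma eq_subst_of_rec {h : R⟦X⟧} (hh : constantCoeff h = 0) (A : R⟦X⟧ → R⟦X⟧)
    (hA : ∀ p, A p = C (constantCoeff p) + h * A (divZ p)) (p : R⟦X⟧) : A p = p.subst h := by
  rw [← sub_eq_zero]
  -- Each use of the recursion extracts a factor h, hence a factor X, from the difference.
  refine eq_zero_of_X_pow_dvd fun n => ?_
  induction n generalizing p with
  | zero => simp
  | succ n ih =>
    rw [hA, subst_eq_C_add hh, add_sub_add_left_eq_sub, ← mul_sub, pow_succ']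
    exact mul_dvd_mul (X_dvd_iff.2 hh) (ih _)

/-- With one mark left free, the recursion for marked sums is that of a substitution. The series to
be substituted, h or k, is X times the generating function in which the other mark has shifted
weights. -/
lemma box_eq_subst (f g : M1 R) : ∃ h k : R⟦X⟧, constantCoeff h = 0 ∧ constantCoeff k = 0 ∧
    h = X * (divZ g.1).subst k ∧ k = X * (divZ f.1).subst h ∧
    (M1.box f g).1 = f.1.subst h ∧ (M1.box f g).1 = g.1.subst k := by
  -- Taking 1 + f instead of f gives the empty block weight 1.
  let a : ℕ → R := fun n => coeff n (1 + f.1)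
  let b : ℕ → R := fun n => coeff n (1 + g.1)
  have ha : a 0 = 1 := by simp [a, f.2]
  have hb : b 0 = 1 := by simp [b, g.2]
  let A : R⟦X⟧ → R⟦X⟧ := fun p => mk (markedSum a b (fun n => coeff n p) b)
  let B : R⟦X⟧ → R⟦X⟧ := fun q => mk (markedSum a b a (fun n => coeff n q))
  let h : R⟦X⟧ := X * B (divZ g.1)
  let k : R⟦X⟧ := X * A (divZ f.1)
  have hh : constantCoeff h = 0 := by simp [h]
  have hk : constantCoeff k = 0 := by simp [k]
  have hdf : (fun n => a (n + 1)) = fun n => coeff n (divZ f.1) := by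
    ext n; simp [a, divZ, coeff_one]
  have hdg : (fun n => b (n + 1)) = fun n => coeff n (divZ g.1) := by
    ext n; simp [b, divZ, coeff_one]
  have hA : ∀ p, A p = p.subst h := by
    refine eq_subst_of_rec hh A fun p => ?_
    ext n
    cases n with
    | zero => simp [A, h, markedSum_zero, hb]
    | succ n =>
      simp only [A, h, coeff_mk, map_add, mul_assoc, coeff_succ_X_mul, markedSum_succ ha hb, hdg]
      rw [mul_comm, coeff_mul]
      simp [B, divZ]
  have hB : ∀ p, B p = p.subst k := by
    refine eq_subst_of_rec hk B fun p => ?_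
    ext n
    cases n with
    | zero => simp [B, k, markedSum_zero, ha]
    | succ n =>
      simp only [B, k, coeff_mk, map_add, mul_assoc, coeff_succ_X_mul, markedSum_succ ha hb, hdf]
      rw [coeff_mul]
      simp [A, divZ]
  have hblock : ∀ (f : R⟦X⟧) {n : ℕ} (π : Part n),
      blockWeight (fun n => coeff n (1 + f)) π = blockProd f π := by
    intro f n π
    refine Finset.prod_congr rfl fun V hV => ?_
    have := (π.nonempty_of_mem_parts hV).card_pos
    simp [coeff_one, this.ne']
  -- This one series equals both A (1 + f) and B (1 + g), which yields the two formulas for f ⊠ g.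
  have hbox : 1 + (M1.box f g).1 = mk (markedSum a b a b) := by
    ext n
    rcases n with _ | n
    · simp [markedSum_zero, ha, hb, (M1.box f g).2]
    · rw [coeff_mk, markedSum_self ha hb]
      simp only [a, b, hblock]
      simp [M1.box, boxCoeff, coeff_one]
  have hone : ∀ {x : R⟦X⟧} (hx : constantCoeff x = 0) (p : R⟦X⟧),
      (1 + p).subst x = 1 + p.subst x := by
    intro x hx p
    have hs : HasSubst x := HasSubst.of_constantCoeff_zero' hx
    rw [subst_add hs, ← coe_substAlgHom hs, map_one]
  refine ⟨h, k, hh, hk, by rw [← hB], by rw [← hA], ?_, ?_⟩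
  · rw [← add_right_inj 1, hbox, ← hone hh, ← hA]
  · rw [← add_right_inj 1, hbox, ← hone hk, ← hB]

end Functional

/-! ### Compositional inverses and the `F`-transform -/

section Transform

variable {R : Type*} [CommRing R]

lemma constantCoeff_subst_of_zero {h : R⟦X⟧} (hh : constantCoeff h = 0) (f : R⟦X⟧) :
    constantCoeff (f.subst h) = constantCoeff f := by
  rw [subst_eq_C_add hh]
  simp [hh]

lemma subst_subst {g h : R⟦X⟧} (hg : constantCoeff g = 0) (hh : constantCoeff h = 0) (f : R⟦X⟧) :
    subst h (subst g f) = subst (subst h g) f :=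
  subst_comp_subst_apply (HasSubst.of_constantCoeff_zero' hg) (HasSubst.of_constantCoeff_zero' hh) f

lemma X_subst_of_zero {h : R⟦X⟧} (hh : constantCoeff h = 0) : (X : R⟦X⟧).subst h = h :=
  subst_X (HasSubst.of_constantCoeff_zero' hh)

lemma mul_subst_of_zero {h : R⟦X⟧} (hh : constantCoeff h = 0) (f g : R⟦X⟧) :
    (f * g).subst h = f.subst h * g.subst h :=
  subst_mul (HasSubst.of_constantCoeff_zero' hh) f g

namespace G1

lemma constantCoeff_compInv (f : G1 R) : constantCoeff f.compInv = 0 :=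
  constantCoeff_substInvOfIsUnit ..

lemma X_mul_FT (f : G1 R) : X * (FT f).1 = f.compInv := X_mul_divZ _ f.constantCoeff_compInv

lemma subst_compInv (f : G1 R) : f.1.subst f.compInv = X :=
  subst_substInvOfIsUnit_right f.1 f.2.1 _

lemma compInv_subst (f : G1 R) : f.compInv.subst f.1 = X :=
  subst_substInvOfIsUnit_left f.1 f.2.1 _

lemma eq_compInv (f : G1 R) {h : R⟦X⟧} (hh : constantCoeff h = 0) (hf : f.1.subst h = X) :
    h = f.compInv := by
  rw [← X_subst f.compInv, ← hf, ← subst_subst f.2.1 hh, f.compInv_subst, X_subst_of_zero hh]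

lemma coeff_one_X_mul (g : R⟦X⟧) : coeff 1 (X * g) = constantCoeff g := by
  simp

/-- The series `z g(z)` for a series `g` with constant term `1`. -/
noncomputable def ofLam (g : Lam R) : G1 R :=
  ⟨X * g.1, by simp, by rw [coeff_one_X_mul, g.2]⟩

/-- This recovers f from its F-transform. -/
lemma compInv_ofLam_FT (f : G1 R) : (ofLam (FT f)).compInv = f.1 :=
  ((ofLam (FT f)).eq_compInv f.2.1
    ((congrArg (subst f.1) f.X_mul_FT).trans f.compInv_subst)).symm

/-- Substituting g in g⁻¹(z)/z gives z/g. -/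
lemma divZ_mul_FT_subst (g : G1 R) : divZ g.1 * (FT g).1.subst g.1 = 1 := by
  apply X_mul_cancel
  rw [← mul_assoc, X_mul_divZ _ g.2.1, FT, ← subst_eq_mul_divZ g.2.1 g.constantCoeff_compInv,
    g.compInv_subst, mul_one]

end G1

lemma divZ_X_mul (g : R⟦X⟧) : divZ (X * g) = g := by
  ext n
  simp [divZ, coeff_succ_X_mul]

lemma FT_bijective : Function.Bijective (FT (R := R)) := by
  constructor
  · intro f g h
    rw [← Subtype.coe_inj, ← f.compInv_ofLam_FT, h, g.compInv_ofLam_FT]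
  · intro g
    let f : G1 R := ⟨(G1.ofLam g).compInv, (G1.ofLam g).constantCoeff_compInv, by
      rw [← G1.X_mul_FT, G1.coeff_one_X_mul, (FT _).2]⟩
    have h : (G1.ofLam g).1 = f.compInv :=
      f.eq_compInv (G1.ofLam g).2.1 (G1.ofLam g).compInv_subst
    refine ⟨f, Subtype.ext ?_⟩
    exact (congrArg divZ h.symm).trans (divZ_X_mul g.1)

lemma FT_box (f g : G1 R) : FT (G1.box f g) = Lam.mul (FT f) (FT g) := by
  obtain ⟨h, k, hh, hk, e₁, e₂, e₃, e₄⟩ := box_eq_subst f.toM1 g.toM1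
  set u := G1.box f g
  have e₃ : u.1 = f.1.subst h := e₃
  have e₄ : u.1 = g.1.subst k := e₄
  have e₅ : f.compInv.subst u.1 = h := by
    rw [e₃, ← subst_subst f.2.1 hh, f.compInv_subst, X_subst_of_zero hh]
  have e₆ : g.compInv.subst u.1 = k := by
    rw [e₄, ← subst_subst g.2.1 hk, g.compInv_subst, X_subst_of_zero hk]
  have e₇ : h * k = X * u.1 := by
    rw [e₄, subst_eq_mul_divZ hk g.2.1, e₁]
    change X * (divZ g.1).subst k * k = _
    ring
  -- Substitution of u⁻¹ turns h = f⁻¹(u) into f⁻¹, k into g⁻¹ and u into z.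
  have e₈ : f.compInv * g.compInv = u.compInv * X := by
    have := congrArg (subst u.compInv) e₇
    have hu := u.constantCoeff_compInv
    rwa [mul_subst_of_zero hu, mul_subst_of_zero hu, ← e₅, ← e₆, subst_subst u.2.1 hu,
      subst_subst u.2.1 hu, u.subst_compInv, X_subst, X_subst, X_subst_of_zero hu] at this
  refine Subtype.ext (X_mul_cancel (X_mul_cancel ?_))
  change X * (X * (FT u).1) = X * (X * ((FT f).1 * (FT g).1))
  calc X * (X * (FT u).1) = X * (FT u).1 * X := by ring
    _ = (X * (FT f).1) * (X * (FT g).1) := by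
      rw [G1.X_mul_FT, G1.X_mul_FT, G1.X_mul_FT, e₈]
    _ = _ := by ring

/-- Elimination of k, using that (g/z)(k) is inverse to F(g)(g(k)), leaves an equation for h in
which g enters only through F(g). -/
lemma box_eq_subst_of_G1 (f : M1 R) (g : G1 R) : ∃ h : R⟦X⟧, constantCoeff h = 0 ∧
    (M1.box f g.toM1).1 = f.1.subst h ∧ h * (FT g).1.subst (f.1.subst h) = X := by
  obtain ⟨h, k, hh, hk, e₁, -, e₃, e₄⟩ := box_eq_subst f g.toM1
  refine ⟨h, hh, e₃, ?_⟩
  have e₄ : (M1.box f g.toM1).1 = g.1.subst k := e₄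
  have e₁ : h = X * (divZ g.1).subst k := e₁
  rw [← e₃, e₄, ← subst_subst g.2.1 hk, e₁, mul_assoc, ← mul_subst_of_zero hk,
    g.divZ_mul_FT_subst, ← coe_substAlgHom (HasSubst.of_constantCoeff_zero' hk), map_one, mul_one]

/-- The equation says that h is the compositional inverse of z·F(g)(f), so it has only one solution.
-/
lemma box_eq_of_mul_eq_X (f : M1 R) (g : G1 R) {h : R⟦X⟧} (hh : constantCoeff h = 0)
    (e : h * (FT g).1.subst (f.1.subst h) = X) : (M1.box f g.toM1).1 = f.1.subst h := by
  obtain ⟨h', hh', e', e''⟩ := box_eq_subst_of_G1 f g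
  let k : G1 R := G1.ofLam ⟨(FT g).1.subst f.1, by
    rw [constantCoeff_subst_of_zero f.2, (FT g).2]⟩
  have hk : ∀ {x : R⟦X⟧}, constantCoeff x = 0 → x * (FT g).1.subst (f.1.subst x) = X →
      x = k.compInv := by
    intro x hx ex
    refine k.eq_compInv hx ?_
    change (X * (FT g).1.subst f.1).subst x = X
    rw [mul_subst_of_zero hx, X_subst_of_zero hx, subst_subst f.2 hx, ex]
  rw [e', hk hh' e'', hk hh e]

/-- If h and k solve the equations of the two successive products, then h(k) solves the one for
F(g)F(g') = F(g ⊠ g'). -/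
lemma box_box (f : M1 R) (g g' : G1 R) :
    M1.box (M1.box f g.toM1) g'.toM1 = M1.box f (G1.box g g').toM1 := by
  obtain ⟨h, hh, e, e'⟩ := box_eq_subst_of_G1 f g
  obtain ⟨k, hk, d, d'⟩ := box_eq_subst_of_G1 (M1.box f g.toM1) g'
  have hc : constantCoeff (h.subst k) = 0 := by rw [constantCoeff_subst_of_zero hk, hh]
  apply Subtype.ext
  rw [box_eq_of_mul_eq_X f (G1.box g g') hc, d, e, subst_subst hh hk]
  rw [FT_box]
  change _ * ((FT g).1 * (FT g').1).subst _ = X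
  have hf : constantCoeff (f.1.subst h) = 0 := by rw [constantCoeff_subst_of_zero hh, f.2]
  have e'' := congrArg (subst k) e'
  rw [mul_subst_of_zero hk, X_subst_of_zero hk, subst_subst hf hk, subst_subst hh hk] at e''
  rw [e, subst_subst hh hk] at d'
  rw [mul_subst_of_zero (by rw [constantCoeff_subst_of_zero hc, f.2]), ← mul_assoc, e'', d']

lemma FT_one : FT (G1.one (R := R)) = Lam.one := by
  have : (G1.one (R := R)).compInv = X :=
    (G1.one.eq_compInv (by simp) (X_subst_of_zero (by simp))).symm
  refine Subtype.ext ?_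
  exact (congrArg divZ (this.trans (mul_one X).symm)).trans (divZ_X_mul 1)

lemma box_one (f : M1 R) : M1.box f G1.one.toM1 = f := by
  apply Subtype.ext
  rw [box_eq_of_mul_eq_X f G1.one (h := X) (by simp), X_subst]
  rw [FT_one, X_subst, Lam.one,
    ← coe_substAlgHom (HasSubst.of_constantCoeff_zero' f.2), map_one, mul_one]

end Transform

/-! ### The logarithmic derivative -/

section Dlog

variable {R : Type*} [CommRing R]

lemma Lam.isUnit (f : Lam R) : IsUnit f.1 :=
  isUnit_iff_constantCoeff.2 (f.2.symm ▸ isUnit_one)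

lemma isAbelianGroup_Lam : IsAbelianGroup (Lam.mul (R := R)) Lam.one where
  assoc a b c := Subtype.ext (mul_assoc _ _ _)
  comm a b := Subtype.ext (mul_comm _ _)
  id_left a := Subtype.ext (one_mul _)
  inv_left a := by
    obtain ⟨b, hb⟩ := a.isUnit.exists_left_inv
    refine ⟨⟨b, ?_⟩, Subtype.ext hb⟩
    have := congrArg constantCoeff hb
    rwa [map_mul, a.2, mul_one, map_one] at this

variable [Algebra ℚ R]

/-- This replaces the logarithm by the differential equation f' = f·a, to which later arguments
reduce. -/
lemma mul_dlog (f : Lam R) : f.1 * dlog f = derivative R f.1 := by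
  have h0 : constantCoeff (f.1 - 1) = 0 := by rw [map_sub, f.2, map_one, sub_self]
  have hs : HasSubst (f.1 - 1) := HasSubst.of_constantCoeff_zero' h0
  have hlog : (1 + X) * derivative R (log R) = 1 := by
    rw [deriv_log]
    ext n
    rw [add_mul, one_mul, map_add]
    cases n with
    | zero => simp
    | succ n => simp [coeff_succ_X_mul, coeff_one, pow_succ]
  have h := congrArg (subst (f.1 - 1)) hlog
  rw [mul_subst_of_zero h0, subst_add hs, X_subst_of_zero h0, ← coe_substAlgHom hs, map_one,
    add_sub_cancel, coe_substAlgHom] at h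
  rw [dlog, logOf_eq, derivative_subst hs, ← mul_assoc, h, one_mul, map_sub, derivative_one,
    sub_zero]

lemma dlog_eq_iff (f : Lam R) (a : R⟦X⟧) : dlog f = a ↔ derivative R f.1 = f.1 * a := by
  rw [← mul_dlog, eq_comm, f.isUnit.mul_right_inj, eq_comm]

lemma dlog_mul (f g : Lam R) : dlog (Lam.mul f g) = dlog f + dlog g := by
  rw [dlog_eq_iff, Lam.mul, Derivation.leibniz, ← mul_dlog, ← mul_dlog, smul_eq_mul, smul_eq_mul]
  ring

lemma dlog_bijective : Function.Bijective (dlog (R := R)) := by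
  have : IsAddTorsionFree R := .of_module_rat R
  constructor
  · intro f g h
    obtain ⟨k, hk⟩ := isAbelianGroup_Lam.inv_left g
    have hf : Lam.mul (Lam.mul f k) g = f := by
      rw [isAbelianGroup_Lam.assoc, hk, isAbelianGroup_Lam.comm, isAbelianGroup_Lam.id_left]
    have h0 : dlog (Lam.mul f k) = 0 := by
      have := dlog_mul (Lam.mul f k) g
      rwa [hf, h, right_eq_add] at this
    rw [dlog_eq_iff, mul_zero] at h0
    have h1 : Lam.mul f k = Lam.one := by
      refine Subtype.ext (derivative.ext ?_ ?_)
      · rw [h0, Lam.one, derivative_one]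
      · rw [(Lam.mul f k).2, Lam.one, map_one]
    rw [← hf, h1, isAbelianGroup_Lam.id_left]
  · intro a
    -- The antiderivative of a. At n = 0 the convention 1 / 0 = 0 makes its constant term vanish.
    let b : R⟦X⟧ := mk fun n => algebraMap ℚ R (1 / n) * coeff (n - 1) a
    have hb : constantCoeff b = 0 := by
      rw [← coeff_zero_eq_constantCoeff_apply, coeff_mk]
      simp
    have hs : HasSubst b := HasSubst.of_constantCoeff_zero' hb
    have hd : derivative R b = a := by
      ext n
      have : ((n : R) + 1) = algebraMap ℚ R (n + 1) := by simp
      rw [coeff_derivative, coeff_mk, mul_right_comm, this, ← map_mul, Nat.cast_succ,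
        one_div_mul_cancel (by positivity), map_one, one_mul, Nat.add_sub_cancel]
    refine ⟨⟨(exp R).subst b, by rw [constantCoeff_subst_of_zero hb, constantCoeff_exp]⟩, ?_⟩
    rw [dlog_eq_iff, derivative_subst hs, derivative_exp, hd]

end Dlog

/-! ### Transport of structure -/

section Transport

variable {α β γ : Type*} {opA : α → α → α} {opB : β → β → β} {opC : γ → γ → γ}

/-- The laws may be checked after applying f, and inverses are pulled back by surjectivity. -/
lemma IsAbelianGroup.of_isGroupIso {e : α} {e' : β} (h : IsAbelianGroup opB e') {f : α → β}
    (hf : IsGroupIso opA opB f) (he : f e = e') : IsAbelianGroup opA e where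
  assoc a b c := hf.bijective.1 (by simp only [hf.map_op, h.assoc])
  comm a b := hf.bijective.1 (by rw [hf.map_op, hf.map_op, h.comm])
  id_left a := hf.bijective.1 (by rw [hf.map_op, he, h.id_left])
  inv_left a := by
    obtain ⟨b, hb⟩ := h.inv_left (f a)
    obtain ⟨b, rfl⟩ := hf.bijective.2 b
    exact ⟨b, hf.bijective.1 (by rw [hf.map_op, hb, he])⟩

lemma IsGroupIso.comp {g : β → γ} (hg : IsGroupIso opB opC g) {f : α → β}
    (hf : IsGroupIso opA opB f) : IsGroupIso opA opC (fun a => g (f a)) where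
  bijective := hg.bijective.comp hf.bijective
  map_op a b := by rw [hf.map_op, hg.map_op]

lemma IsGroupIso.inverse {f : α → β} (hf : IsGroupIso opA opB f) {g : β → α}
    (hg : ∀ b, f (g b) = b) : IsGroupIso opB opA g where
  bijective := by
    have hl : ∀ a, g (f a) = a := fun a => hf.bijective.1 (hg _)
    exact ⟨Function.LeftInverse.injective hg, Function.RightInverse.surjective hl⟩
  map_op a b := hf.bijective.1 (by rw [hf.map_op, hg, hg, hg])

end Transport

/-! ### The isomorphisms of groups -/

section Groups

variable {R : Type*} [CommRing R]

lemma isGroupIso_FT : IsGroupIso G1.box Lam.mul (FT (R := R)) := ⟨FT_bijective, FT_box⟩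

lemma isAbelianGroup_box : IsAbelianGroup (G1.box (R := R)) G1.one :=
  isAbelianGroup_Lam.of_isGroupIso isGroupIso_FT FT_one

lemma moeb_spec : G1.box (moeb R) (zeta R) = G1.one ∧ G1.box (zeta R) (moeb R) = G1.one := by
  obtain ⟨m, hm⟩ := isAbelianGroup_box.inv_left (zeta R)
  exact Classical.epsilon_spec
    (p := fun m => G1.box m (zeta R) = G1.one ∧ G1.box (zeta R) m = G1.one)
    ⟨m, hm, (isAbelianGroup_box.comm _ _).trans hm⟩

/-- Uniqueness identifies the chosen `moeb`, in particular after base change. -/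
lemma eq_moeb {m : G1 R} (hm : G1.box m (zeta R) = G1.one) : m = moeb R := by
  rw [← isAbelianGroup_box.id_left m, ← (moeb_spec (R := R)).1, isAbelianGroup_box.assoc,
    isAbelianGroup_box.comm (zeta R), hm, isAbelianGroup_box.comm, isAbelianGroup_box.id_left]

lemma G1.mulZeta_box_moeb (f : G1 R) : G1.box f.mulZeta (moeb R) = f := by
  rw [G1.mulZeta, isAbelianGroup_box.assoc, moeb_spec.2, isAbelianGroup_box.comm,
    isAbelianGroup_box.id_left]

lemma G1.mulZeta_of_box_moeb (f : G1 R) : (G1.box f (moeb R)).mulZeta = f := by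
  rw [G1.mulZeta, isAbelianGroup_box.assoc, moeb_spec.1, isAbelianGroup_box.comm,
    isAbelianGroup_box.id_left]

/-- The inner Zeta cancels against Moeb: (f ⊠ Zeta) ⊠ Moeb ⊠ (g ⊠ Zeta) = f ⊠ g ⊠ Zeta. -/
lemma isGroupIso_mulZeta : IsGroupIso G1.box G1.boxMulV (G1.mulZeta (R := R)) where
  bijective := ⟨Function.LeftInverse.injective (g := fun f => G1.box f (moeb R)) G1.mulZeta_box_moeb,
    Function.RightInverse.surjective G1.mulZeta_of_box_moeb⟩
  map_op f g := by
    rw [G1.boxMulV, G1.mulZeta_box_moeb, G1.mulZeta, G1.mulZeta, isAbelianGroup_box.assoc]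

lemma isGroupIso_box_moeb :
    IsGroupIso G1.boxMulV G1.box (fun f : G1 R => G1.box f (moeb R)) :=
  isGroupIso_mulZeta.inverse G1.mulZeta_of_box_moeb

lemma isAbelianGroup_boxMulV : IsAbelianGroup (G1.boxMulV (R := R)) (zeta R) :=
  isAbelianGroup_box.of_isGroupIso isGroupIso_box_moeb moeb_spec.2

/-- Substituting w = Zeta⁻¹ in Zeta = z + z·Zeta gives z = w + wz. -/
lemma one_add_X_mul_FT_zeta : (1 + X) * (FT (zeta R)).1 = 1 := by
  have hc := (zeta R).constantCoeff_compInv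
  have hz : (zeta R).1 = X + X * (zeta R).1 := by
    ext n
    rcases n with _ | _ | n <;> simp [zeta, coeff_succ_X_mul, coeff_X]
  have h := congrArg (subst (zeta R).compInv) hz
  rw [subst_add (HasSubst.of_constantCoeff_zero' hc), mul_subst_of_zero hc,
    G1.subst_compInv, X_subst_of_zero hc, ← G1.X_mul_FT] at h
  refine X_mul_cancel ?_
  rw [mul_one]
  conv_rhs => rw [h]
  ring

lemma SV_mulZeta (f : G1 R) : SV f.mulZeta = FT f := by
  refine Subtype.ext ?_
  change (1 + X) * (FT f.mulZeta).1 = _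
  rw [G1.mulZeta, FT_box]
  change (1 + X) * ((FT f).1 * (FT (zeta R)).1) = _
  rw [mul_left_comm, one_add_X_mul_FT_zeta, mul_one]

lemma SV_eq (f : G1 R) : SV f = FT (G1.box f (moeb R)) := by
  rw [← SV_mulZeta, G1.mulZeta_of_box_moeb]

lemma isGroupIso_SV : IsGroupIso G1.boxMulV Lam.mul (SV (R := R)) := by
  rw [funext SV_eq]
  exact isGroupIso_FT.comp isGroupIso_box_moeb

lemma isAbelianGroup_add : IsAbelianGroup (fun f g : R⟦X⟧ => f + g) 0 :=
  ⟨add_assoc, add_comm, zero_add, fun a => ⟨-a, neg_add_cancel a⟩⟩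

lemma isGroupIso_ident : IsGroupIso M1.add (fun f g => f + g) (M1.ident (R := R)) where
  bijective := by
    refine ⟨fun f g h => Subtype.ext ?_, fun g => ⟨⟨X * g, by simp⟩, divZ_X_mul g⟩⟩
    rw [← X_mul_divZ f.1 f.2, ← X_mul_divZ g.1 g.2]
    exact congrArg (X * ·) h
  map_op f g := by
    ext n
    simp [M1.ident, M1.add, divZ]

lemma isAbelianGroup_M1_add : IsAbelianGroup (M1.add (R := R)) M1.zero :=
  isAbelianGroup_add.of_isGroupIso isGroupIso_ident (by ext n; simp [M1.ident, M1.zero, divZ])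

lemma RV_mulZeta (f : M1 R) : RV f.mulZeta = f := by
  rw [RV, M1.mulZeta, box_box, moeb_spec.2, box_one]

lemma M1.mulZeta_RV (f : M1 R) : (RV f).mulZeta = f := by
  rw [RV, M1.mulZeta, box_box, moeb_spec.1, box_one]

lemma isGroupIso_M1_mulZeta : IsGroupIso M1.add M1.boxAddV (M1.mulZeta (R := R)) where
  bijective := ⟨Function.LeftInverse.injective RV_mulZeta,
    Function.RightInverse.surjective M1.mulZeta_RV⟩
  map_op f g := by
    change _ = (M1.add (RV f.mulZeta) (RV g.mulZeta)).mulZeta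
    rw [RV_mulZeta, RV_mulZeta]

lemma isGroupIso_RV : IsGroupIso M1.boxAddV M1.add (RV (R := R)) :=
  isGroupIso_M1_mulZeta.inverse M1.mulZeta_RV

lemma M1.zero_mulZeta : (M1.zero (R := R)).mulZeta = M1.zero := by
  obtain ⟨h, hh, e, -⟩ := box_eq_subst_of_G1 M1.zero (zeta R)
  refine Subtype.ext (e.trans ?_)
  rw [M1.zero, ← coe_substAlgHom (HasSubst.of_constantCoeff_zero' hh), map_zero]

lemma RV_zero : RV (M1.zero (R := R)) = M1.zero := by
  conv_lhs => rw [← M1.zero_mulZeta, RV_mulZeta]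

lemma isAbelianGroup_boxAddV : IsAbelianGroup (M1.boxAddV (R := R)) M1.zero :=
  isAbelianGroup_M1_add.of_isGroupIso isGroupIso_RV RV_zero

variable [Algebra ℚ R]

lemma isGroupIso_dlog : IsGroupIso Lam.mul (fun f g => f + g) (dlog (R := R)) :=
  ⟨dlog_bijective, dlog_mul⟩

lemma isGroupIso_LOG : IsGroupIso G1.box (fun f g => f + g) (LOG (R := R)) :=
  isGroupIso_dlog.comp isGroupIso_FT

/-- Bijectivity of `LOG` makes the `Function.invFun` in `EXP` a genuine inverse. -/
lemma LOG_EXP (f : M1 R) : LOG (EXP f) = f.ident :=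
  Function.rightInverse_invFun isGroupIso_LOG.bijective.2 _

lemma EXP_eq_iff (f : M1 R) (g : G1 R) : EXP f = g ↔ LOG g = f.ident := by
  rw [← LOG_EXP, eq_comm]
  exact isGroupIso_LOG.bijective.1.eq_iff.symm

lemma isGroupIso_EXP : IsGroupIso M1.add G1.box (EXP (R := R)) :=
  (isGroupIso_LOG.inverse (Function.rightInverse_invFun isGroupIso_LOG.bijective.2)).comp
    isGroupIso_ident

lemma isGroupIso_EXPV : IsGroupIso M1.boxAddV G1.boxMulV (EXPV (R := R)) :=
  isGroupIso_mulZeta.comp (isGroupIso_EXP.comp isGroupIso_RV)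

lemma EXPV_LOGV (g : G1 R) : EXPV (LOGV g) = g :=
  Function.rightInverse_invFun isGroupIso_EXPV.bijective.2 g

lemma EXPV_eq_iff (m : M1 R) (g : G1 R) : EXPV m = g ↔ LOGV g = m := by
  rw [← isGroupIso_EXPV.bijective.1.eq_iff, EXPV_LOGV, eq_comm]

lemma isGroupIso_LOGV : IsGroupIso G1.boxMulV M1.boxAddV (LOGV (R := R)) :=
  isGroupIso_EXPV.inverse EXPV_LOGV

end Groups

/-! ### Random variables -/

section Moments

variable {A R : Type*} [Ring A] [CommRing R]

/-- All coefficients of Zeta in positive degree are 1, so the complement contributes a factor 1 and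
the moment-cumulant formula remains. -/
lemma momentSeries_eq (φ : A → R) (a : A) :
    momentSeries φ a = (cumulantSeries φ a).mulZeta := by
  refine Subtype.ext ?_
  ext n
  rcases eq_or_ne n 0 with rfl | hn
  · simp [momentSeries, M1.mulZeta, M1.box]
  · simp only [momentSeries, M1.mulZeta, M1.box, coeff_mk, if_neg hn, boxCoeff]
    have h := moment_cumulant φ hn (fun _ => a)
    rw [List.ofFn_const, List.prod_replicate] at h
    rw [h]
    refine Finset.sum_congr rfl fun π _ => ?_
    have hV : ∀ {π : Part n}, ∀ V ∈ π.parts, V.card ≠ 0 := fun {π} V hV =>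
      (π.nonempty_of_mem_parts hV).card_pos.ne'
    rw [blockProd, blockProd, Finset.prod_eq_one (s := (kreweras π).parts), mul_one]
    · refine Finset.prod_congr rfl fun V h => ?_
      simp [cumulantSeries, hV V h]
    · intro V h
      simp [zeta, G1.toM1, hV V h]

end Moments

/-! ### Naturality -/

section Naturality

variable {R S : Type*} [CommRing R] [CommRing S] (φ : R →+* S)

/-- The coefficients of f ⊠ g are integer polynomials in those of f and g. -/
lemma M1.map_box (f g : M1 R) : (M1.box f g).map φ = M1.box (f.map φ) (g.map φ) := by
  refine Subtype.ext ?_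
  ext n
  rcases eq_or_ne n 0 with rfl | hn
  · simp [M1.map, M1.box]
  · simp [M1.map, M1.box, hn, boxCoeff, blockProd, map_sum, map_prod]

lemma G1.map_box (f g : G1 R) : (G1.box f g).map φ = G1.box (f.map φ) (g.map φ) :=
  Subtype.ext (congrArg (fun x : M1 S => x.1) (M1.map_box φ f.toM1 g.toM1))

lemma map_zeta : (zeta R).map φ = zeta S := by
  refine Subtype.ext ?_
  ext n
  simp [G1.map, zeta, apply_ite φ]

lemma G1.map_one : (G1.one (R := R)).map φ = G1.one := by
  refine Subtype.ext ?_
  simp [G1.map, G1.one]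

lemma map_moeb : (moeb R).map φ = moeb S :=
  eq_moeb (by rw [← map_zeta φ, ← G1.map_box, moeb_spec.1, G1.map_one])

lemma G1.map_mulZeta (f : G1 R) : (f.map φ).mulZeta = f.mulZeta.map φ := by
  rw [G1.mulZeta, G1.mulZeta, G1.map_box, map_zeta]

lemma G1.map_boxMulV (f g : G1 R) :
    (G1.boxMulV f g).map φ = G1.boxMulV (f.map φ) (g.map φ) := by
  rw [G1.boxMulV, G1.boxMulV, G1.map_box, G1.map_box, map_moeb]

lemma M1.map_mulZeta (f : M1 R) : (f.map φ).mulZeta = f.mulZeta.map φ := by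
  rw [M1.mulZeta, M1.mulZeta, M1.map_box, ← map_zeta φ]
  rfl

lemma map_RV (f : M1 R) : RV (f.map φ) = (RV f).map φ := by
  rw [RV, RV, M1.map_box, ← map_moeb φ]
  rfl

lemma M1.map_add (f g : M1 R) : (M1.add f g).map φ = M1.add (f.map φ) (g.map φ) :=
  Subtype.ext (_root_.map_add _ _ _)

lemma M1.map_boxAddV (f g : M1 R) :
    (M1.boxAddV f g).map φ = M1.boxAddV (f.map φ) (g.map φ) := by
  change (M1.add (RV f) (RV g)).mulZeta.map φ = (M1.add (RV (f.map φ)) (RV (g.map φ))).mulZeta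
  rw [← M1.map_mulZeta, M1.map_add, map_RV, map_RV]

lemma Lam.map_mul (f g : Lam R) : (Lam.mul f g).map φ = Lam.mul (f.map φ) (g.map φ) :=
  Subtype.ext (_root_.map_mul _ _ _)

/-- Base change preserves the equation f(f⁻¹) = z, which determines f⁻¹. -/
lemma map_compInv (f : G1 R) : (f.map φ).compInv = PowerSeries.map φ f.compInv := by
  have hc := f.constantCoeff_compInv
  symm
  refine G1.eq_compInv _ ?_ ?_
  · rw [← coeff_zero_eq_constantCoeff_apply, coeff_map, coeff_zero_eq_constantCoeff_apply, hc,
      map_zero]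
  · have h := congrArg (PowerSeries.map φ) f.subst_compInv
    rw [PowerSeries.map_X] at h
    rw [← h]
    exact (map_subst (HasSubst.of_constantCoeff_zero' hc) f.1).symm

lemma map_divZ (f : R⟦X⟧) : divZ (PowerSeries.map φ f) = PowerSeries.map φ (divZ f) := by
  ext n
  simp [divZ]

lemma map_FT (f : G1 R) : FT (f.map φ) = (FT f).map φ :=
  Subtype.ext ((congrArg divZ (map_compInv φ f)).trans (map_divZ φ _))

lemma map_SV (f : G1 R) : SV (f.map φ) = (SV f).map φ := by
  rw [SV_eq, SV_eq, ← map_FT, G1.map_box, map_moeb]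

lemma map_derivative (f : R⟦X⟧) :
    derivative S (PowerSeries.map φ f) = PowerSeries.map φ (derivative R f) := by
  ext n
  simp [coeff_derivative]

variable [Algebra ℚ R] [Algebra ℚ S]

lemma map_dlog (f : Lam R) : dlog (f.map φ) = PowerSeries.map φ (dlog f) := by
  rw [dlog_eq_iff, Lam.map, map_derivative, ← mul_dlog, map_mul]

lemma map_EXP (f : M1 R) : EXP (f.map φ) = (EXP f).map φ := by
  rw [EXP_eq_iff, LOG, map_FT, map_dlog]
  exact (congrArg _ (LOG_EXP f)).trans (map_divZ φ f.1).symm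

lemma map_EXPV (m : M1 R) : EXPV (m.map φ) = (EXPV m).map φ := by
  rw [EXPV, EXPV, map_RV, map_EXP, G1.map_mulZeta]

end Naturality

end FreeConv
-- Assembly of the diagram
theorem mainTheorem4 (R : Type*) [CommRing R] [Algebra ℚ R] :
    -- `Moeb` is the two-sided `⊠`-inverse of `Zeta`
    (FreeConv.G1.box (FreeConv.moeb R) (FreeConv.zeta R) = FreeConv.G1.one ∧
      FreeConv.G1.box (FreeConv.zeta R) (FreeConv.moeb R) = FreeConv.G1.one) ∧
    -- the six vertices of the diagram are abelian groups
    (FreeConv.IsAbelianGroup (FreeConv.G1.box (R := R)) FreeConv.G1.one ∧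
      FreeConv.IsAbelianGroup (FreeConv.G1.boxMulV (R := R)) (FreeConv.zeta R) ∧
      FreeConv.IsAbelianGroup (FreeConv.Lam.mul (R := R)) FreeConv.Lam.one ∧
      FreeConv.IsAbelianGroup (fun f g : PowerSeries R => f + g) 0 ∧
      FreeConv.IsAbelianGroup (FreeConv.M1.add (R := R)) FreeConv.M1.zero ∧
      FreeConv.IsAbelianGroup (FreeConv.M1.boxAddV (R := R)) FreeConv.M1.zero) ∧
    -- the nine arrows of the diagram are isomorphisms of groups
    (FreeConv.IsGroupIso FreeConv.G1.box FreeConv.G1.boxMulV (FreeConv.G1.mulZeta (R := R)) ∧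
      FreeConv.IsGroupIso FreeConv.G1.box FreeConv.Lam.mul (FreeConv.FT (R := R)) ∧
      FreeConv.IsGroupIso FreeConv.G1.boxMulV FreeConv.Lam.mul (FreeConv.SV (R := R)) ∧
      FreeConv.IsGroupIso FreeConv.Lam.mul (fun f g => f + g) (FreeConv.dlog (R := R)) ∧
      FreeConv.IsGroupIso FreeConv.M1.add (fun f g => f + g) (FreeConv.M1.ident (R := R)) ∧
      FreeConv.IsGroupIso FreeConv.M1.boxAddV (fun f g => f + g)
        (fun m : FreeConv.M1 R => (FreeConv.RV m).ident) ∧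
      FreeConv.IsGroupIso FreeConv.M1.add FreeConv.M1.boxAddV (FreeConv.M1.mulZeta (R := R)) ∧
      FreeConv.IsGroupIso FreeConv.M1.add FreeConv.G1.box (FreeConv.EXP (R := R)) ∧
      FreeConv.IsGroupIso FreeConv.M1.boxAddV FreeConv.G1.boxMulV (FreeConv.EXPV (R := R))) ∧
    -- the diagram commutes: upper, left, right and lower inner faces, and the outer rectangle
    ((∀ f : FreeConv.G1 R, FreeConv.SV f.mulZeta = FreeConv.FT f) ∧
      (∀ f : FreeConv.M1 R, FreeConv.dlog (FreeConv.FT (FreeConv.EXP f)) = f.ident) ∧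
      (∀ m : FreeConv.M1 R,
        FreeConv.dlog (FreeConv.SV (FreeConv.EXPV m)) = (FreeConv.RV m).ident) ∧
      (∀ f : FreeConv.M1 R, (FreeConv.RV f.mulZeta).ident = f.ident) ∧
      (∀ f : FreeConv.M1 R, FreeConv.EXPV f.mulZeta = (FreeConv.EXP f).mulZeta)) ∧
    -- `LOG` and `LOG_V` are isomorphisms, with inverses `EXP` and `EXP_V`
    (FreeConv.IsGroupIso FreeConv.G1.box (fun f g => f + g) (FreeConv.LOG (R := R)) ∧
      (∀ (f : FreeConv.M1 R) (g : FreeConv.G1 R),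
        FreeConv.EXP f = g ↔ FreeConv.LOG g = f.ident) ∧
      FreeConv.IsGroupIso FreeConv.G1.boxMulV FreeConv.M1.boxAddV (FreeConv.LOGV (R := R)) ∧
      (∀ (m : FreeConv.M1 R) (g : FreeConv.G1 R),
        FreeConv.EXPV m = g ↔ FreeConv.LOGV g = m)) ∧
    -- multiplicative free convolution is reduced to the additive one
    (∀ f g : FreeConv.G1 R, FreeConv.G1.boxMulV f g =
      FreeConv.EXPV (FreeConv.M1.boxAddV (FreeConv.LOGV f) (FreeConv.LOGV g))) ∧
    -- `M(a) = R(a) ⊠ Zeta` and `R_V(M(a)) = R(a)` for random variables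
    (∀ (k A : Type*) [CommRing k] [Ring A] [Algebra k A] [Algebra k R] (φ : A →ₗ[k] R),
      φ 1 = 1 → ∀ a : A,
        FreeConv.momentSeries φ a = (FreeConv.cumulantSeries φ a).mulZeta ∧
        FreeConv.RV (FreeConv.momentSeries φ a) = FreeConv.cumulantSeries φ a) ∧
    -- all the groups and all the arrows are natural in `R`
    (∀ (S : Type*) [CommRing S] [Algebra ℚ S] (φ : R →ₐ[ℚ] S),
      ((∀ f g : FreeConv.G1 R, (FreeConv.G1.box f g).map (φ : R →+* S) =
          FreeConv.G1.box (f.map (φ : R →+* S)) (g.map (φ : R →+* S))) ∧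
        (∀ f g : FreeConv.G1 R, (FreeConv.G1.boxMulV f g).map (φ : R →+* S) =
          FreeConv.G1.boxMulV (f.map (φ : R →+* S)) (g.map (φ : R →+* S))) ∧
        (∀ f g : FreeConv.Lam R, (FreeConv.Lam.mul f g).map (φ : R →+* S) =
          FreeConv.Lam.mul (f.map (φ : R →+* S)) (g.map (φ : R →+* S))) ∧
        (∀ f g : FreeConv.M1 R, (FreeConv.M1.add f g).map (φ : R →+* S) =
          FreeConv.M1.add (f.map (φ : R →+* S)) (g.map (φ : R →+* S))) ∧
        (∀ f g : FreeConv.M1 R, (FreeConv.M1.boxAddV f g).map (φ : R →+* S) =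
          FreeConv.M1.boxAddV (f.map (φ : R →+* S)) (g.map (φ : R →+* S)))) ∧
      (∀ f : FreeConv.G1 R, (f.map (φ : R →+* S)).mulZeta = f.mulZeta.map (φ : R →+* S)) ∧
      (∀ f : FreeConv.G1 R,
        FreeConv.FT (f.map (φ : R →+* S)) = (FreeConv.FT f).map (φ : R →+* S)) ∧
      (∀ f : FreeConv.G1 R,
        FreeConv.SV (f.map (φ : R →+* S)) = (FreeConv.SV f).map (φ : R →+* S)) ∧
      (∀ f : FreeConv.Lam R, FreeConv.dlog (f.map (φ : R →+* S)) =
        PowerSeries.map (φ : R →+* S) (FreeConv.dlog f)) ∧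
      (∀ f : FreeConv.M1 R,
        (f.map (φ : R →+* S)).ident = PowerSeries.map (φ : R →+* S) f.ident) ∧
      (∀ m : FreeConv.M1 R,
        FreeConv.RV (m.map (φ : R →+* S)) = (FreeConv.RV m).map (φ : R →+* S)) ∧
      (∀ f : FreeConv.M1 R, (f.map (φ : R →+* S)).mulZeta = f.mulZeta.map (φ : R →+* S)) ∧
      (∀ f : FreeConv.M1 R,
        FreeConv.EXP (f.map (φ : R →+* S)) = (FreeConv.EXP f).map (φ : R →+* S)) ∧
      (∀ m : FreeConv.M1 R,
        FreeConv.EXPV (m.map (φ : R →+* S)) = (FreeConv.EXPV m).map (φ : R →+* S))) := by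
  refine ⟨FreeConv.moeb_spec, ⟨FreeConv.isAbelianGroup_box, FreeConv.isAbelianGroup_boxMulV,
    FreeConv.isAbelianGroup_Lam, FreeConv.isAbelianGroup_add, FreeConv.isAbelianGroup_M1_add,
    FreeConv.isAbelianGroup_boxAddV⟩, ⟨FreeConv.isGroupIso_mulZeta, FreeConv.isGroupIso_FT,
    FreeConv.isGroupIso_SV, FreeConv.isGroupIso_dlog, FreeConv.isGroupIso_ident,
    FreeConv.isGroupIso_ident.comp FreeConv.isGroupIso_RV, FreeConv.isGroupIso_M1_mulZeta,
    FreeConv.isGroupIso_EXP, FreeConv.isGroupIso_EXPV⟩, ⟨FreeConv.SV_mulZeta, FreeConv.LOG_EXP,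
    fun m => ?_, fun f => ?_, fun f => ?_⟩, ⟨FreeConv.isGroupIso_LOG, FreeConv.EXP_eq_iff,
    FreeConv.isGroupIso_LOGV, FreeConv.EXPV_eq_iff⟩, fun f g => ?_, ?_, ?_⟩
  · rw [FreeConv.EXPV, FreeConv.SV_mulZeta]
    exact FreeConv.LOG_EXP _
  · rw [FreeConv.RV_mulZeta]
  · rw [FreeConv.EXPV, FreeConv.RV_mulZeta]
  · rw [FreeConv.isGroupIso_EXPV.map_op, FreeConv.EXPV_LOGV, FreeConv.EXPV_LOGV]
  · intro k A _ _ _ _ φ _ a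
    refine ⟨FreeConv.momentSeries_eq φ a, ?_⟩
    rw [FreeConv.momentSeries_eq, FreeConv.RV_mulZeta]
  · intro S _ _ φ
    exact ⟨⟨FreeConv.G1.map_box _, FreeConv.G1.map_boxMulV _, FreeConv.Lam.map_mul _,
      FreeConv.M1.map_add _, FreeConv.M1.map_boxAddV _⟩, FreeConv.G1.map_mulZeta _,
      FreeConv.map_FT _, FreeConv.map_SV _, FreeConv.map_dlog _,
      fun f => FreeConv.map_divZ _ f.1, FreeConv.map_RV _, FreeConv.M1.map_mulZeta _,
      FreeConv.map_EXP _, FreeConv.map_EXPV _⟩
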